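/- Let $\mathbf z$ be a random vector in $\mathbb R^D$ and $\mathbf s$ a random variable in a measurable space, with joint law $p(\mathbf z,\mathbf s)$ and marginals $p(\mathbf z)$, $p(\mathbf s)$. Let $\boldsymbol\epsilon\sim\mathcal N(0,\mathbf I)$ be standard Gaussian noise in $\mathbb R^D$, and for $\gamma\in\mathbb R$ let $\mathbf z_\gamma=\sqrt{\sigma(\gamma)}\,\mathbf z+\sqrt{\sigma(-\gamma)}\,\boldsymbol\epsilon$, where $\sigma(t)=1/(1+e^{-t})$. With $\boldsymbol\epsilon$ independent of $(\mathbf z,\mathbf s)\sim p(\mathbf z,\mathbf s)$, let $\hat{\boldsymbol\epsilon}(\mathbf z_\gamma,\gamma,\mathbf s)=\mathbb E[\boldsymbol\epsilon\mid \mathbf z_\gamma,\mathbf s]$ be the minimum mean square error estimator of $\boldsymbol\epsilon$. Let $q(\tilde{\mathbf s}\mid\mathbf z)$ be a conditional distribution of negatives given $\mathbf z$, and define the denoising gap $$\Delta=\frac12\int_{-\infty}^{\infty}\Big(\mathbb E_{(\mathbf z,\mathbf s)\sim p(\mathbf z,\mathbf s),\,\boldsymbol\epsilon}\big[\|\boldsymbol\epsilon-\hat{\boldsymbol\epsilon}(\mathbf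 z_\gamma,\gamma,\mathbf s)\|^2\big]-\mathbb E_{(\mathbf z,\tilde{\mathbf s})\sim p(\mathbf z)q(\tilde{\mathbf s}\mid\mathbf z),\,\boldsymbol\epsilon}\big[\|\boldsymbol\epsilon-\hat{\boldsymbol\epsilon}(\mathbf z_\gamma,\gamma,\tilde{\mathbf s})\|^2\big]\Big)\,d\gamma ,$$ where in both expectations $\boldsymbol\epsilon$ is independent of the pair. Suppose that the negatives are independent of the input, $q(\tilde{\mathbf s}\mid\mathbf z)=p(\tilde{\mathbf s})$ for $p(\mathbf z)$-almost every $\mathbf z$. Then $$\Delta=-I(\mathbf z;\mathbf s)-D_{\mathrm{KL}}\big(p(\mathbf z)p(\mathbf s)\,\|\,p(\mathbf z,\mathbf s)\big),$$ where $I(\mathbf z;\mathbf s)=D_{\mathrm{KL}}(p(\mathbf z,\mathbf s)\,\|\,p(\mathbf z)p(\mathbf s))$ is the mutual information, and expectations, integrals and divergences may take infinite values. Consequently, in any family of such models, a model minimizes $\Delta$ over the family if and only if it maximizes the Jeffreys divergence $D_{\mathrm{KL}}(p(\mathbf z,\mathbf s)\,\|\,p(\mathbf z)p(\mathbf s))+D_{\mathrm{KL}}(p(\mathbf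 z)p(\mathbf s)\,\|\,p(\mathbf z,\mathbf s))$ over the family. -/

import Mathlib

open MeasureTheory ProbabilityTheory InformationTheory
open scoped ENNReal

namespace DenoisingGap

/-- The space `ℝ^D` of latents, with its Euclidean norm. -/
abbrev Latent (D : ℕ) : Type := EuclideanSpace ℝ (Fin D)

variable {D : ℕ} {S : Type*} [MeasurableSpace S]

/-- The noisy channel `z_γ = √σ(γ) z + √σ(-γ) ε`, where `σ` is the sigmoid function and `γ` is the
log signal-to-noise ratio. -/
noncomputable def noisy (γ : ℝ) (z ε : Latent D) : Latent D :=
  √(Real.sigmoid γ) • z + √(Real.sigmoid (-γ)) • ε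

/-- The law of `((z, s), ε)`, where `(z, s)` has law `ν` and `ε ∼ N(0, I)` is independent of it. -/
noncomputable def noiseLaw (ν : Measure (Latent D × S)) : Measure ((Latent D × S) × Latent D) :=
  ν.prod (stdGaussian (Latent D))

/-- What the denoiser observes at noise level `γ`: the pair `(z_γ, s)`. -/
noncomputable def observation (γ : ℝ) (ω : (Latent D × S) × Latent D) : Latent D × S :=
  (noisy γ ω.1.1 ω.2, ω.1.2)

/-- `εhat` is (a version of) the MMSE estimator of `ε` from `(z_γ, γ, s)`, where `(z, s)` has law
`p`: at every noise level `γ`, `εhat(z_γ, γ, s) = E[ε | z_γ, s]` almost surely. -/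
structure IsMMSEDenoiser (p : Measure (Latent D × S)) (εhat : Latent D → ℝ → S → Latent D) :
    Prop where
  measurable (γ : ℝ) : Measurable (fun o : Latent D × S => εhat o.1 γ o.2)
  ae_eq_condExp (γ : ℝ) :
    (fun ω => εhat (observation γ ω).1 γ (observation γ ω).2) =ᵐ[noiseLaw p]
      (noiseLaw p)[fun ω => ω.2 | MeasurableSpace.comap (observation γ) inferInstance]

/-- The expected squared error `E ‖ε - εhat(z_γ, γ, s)‖²` (possibly infinite), where `(z, s)` has
law `ν` and `ε ∼ N(0, I)` is independent of it. -/
noncomputable def denoisingError (ν : Measure (Latent D × S))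
    (εhat : Latent D → ℝ → S → Latent D) (γ : ℝ) : ℝ≥0∞ :=
  ∫⁻ ω, ‖ω.2 - εhat (noisy γ ω.1.1 ω.2) γ ω.1.2‖ₑ ^ 2 ∂(noiseLaw ν)

/-- The Lebesgue integral over `ℝ` of an extended-real-valued function: the integral of its positive
part minus the integral of its negative part. -/
noncomputable def extIntegral (f : ℝ → EReal) : EReal :=
  ((∫⁻ x, (f x).toENNReal : ℝ≥0∞) : EReal) - ((∫⁻ x, (-f x).toENNReal : ℝ≥0∞) : EReal)

/-- The denoising gap `Δ`: half the integral over all `γ` of the error on aligned pairs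
`(z, s) ∼ p(z, s)` minus the error on mismatched pairs `(z, s̃) ∼ p(z) q(s̃ | z)`. -/
noncomputable def gap (p : Measure (Latent D × S)) (q : Kernel (Latent D) S)
    (εhat : Latent D → ℝ → S → Latent D) : EReal :=
  ((1 / 2 : ℝ) : EReal) * extIntegral (fun γ =>
    (denoisingError p εhat γ : EReal) - (denoisingError (p.fst ⊗ₘ q) εhat γ : EReal))

/-- The mutual information `I(z; s) = KL(p(z, s) ‖ p(z) p(s))` of a joint law `p`. -/
noncomputable def mutualInfo (p : Measure (Latent D × S)) : ℝ≥0∞ :=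
  klDiv p (p.fst.prod p.snd)

/-- The Jeffreys divergence: the sum of the forward and the reverse KL divergences. -/
noncomputable def jeffreysDiv {α : Type*} [MeasurableSpace α] (μ ν : Measure α) : ℝ≥0∞ :=
  klDiv μ ν + klDiv ν μ

end DenoisingGap

/-! Dividing the channel by `√σ(γ)` turns it into `z + √t ε` with `t = e^{-γ}`, i.e. into the heat
flow started at the law of `z` (`noisy_eq_smul`). If `u_t` is the density of `z + √t ε` for `z ∼ μ`,
the posterior mean of `ε` is `-√t ∇ log u_t` (`denoiser`), so by Pythagoras the optimal denoiser for
`ν`, used on `μ`, has an excess error of `t` times the relative Fisher information `J_t(μ‖ν)`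
(`noiseError_denoiser`). Since `|dt| = t dγ`, integrating the excess over `γ` gives `∫₀^∞ J_t dt`,
which is `2 KL(μ‖ν)` by the integrated de Bruijn identity (`klDiv_eq_lintegral_fisherDensity`).

Let `κ_s` be the law of `z` given `s`. On mismatched pairs the denoiser optimal for `κ_s` acts on `z
∼ p(z)`, which costs `t J_t(p(z)‖κ_s)` over the error of the unconditional denoiser. That error,
split over `s`, exceeds the aligned error by the average of `t J_t(κ_s‖p(z))`. Thus both directions
appear (`IsMMSEDenoiser.denoisingError_prod`), and averaging over `s` yields the reverse divergence
and the mutual information (`klDiv_compProd_eq_lintegral`). The aligned error is at most `E‖ε‖²`,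
hence finite, and the integrand of the gap has a constant sign, so the identity survives infinite
divergences.

Most of the work is de Bruijn's identity for arbitrary probability laws, without moments or
finiteness. The integrand of the divergence cannot be controlled at infinity, so it is replaced by
`skewDiv M`, which is at most `(1 + M)|p - q|`. This makes it integrable, so that spatial cutoffs
can be removed, and makes it vanish as `t → ∞`, because any two heat flows merge in total variation.
Letting `M → ∞` restores the divergence at a time `a > 0`. As `a → 0`, data processing gives one
inequality and lower semicontinuity, through the dual formula, the other. -/

namespace DenoisingGap

open Filter Topology Set

/-! ### The heat kernel and its Gaussian law -/

section

variable {D : ℕ}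

/-- The heat kernel: the density of `N(0, t I)` on `ℝ^D`. -/
noncomputable def heatKernel (t : ℝ) (y : Latent D) : ℝ :=
  (2 * Real.pi * t) ^ (-(D : ℝ) / 2) * Real.exp (-‖y‖ ^ 2 / (2 * t))

lemma heatKernel_pos {t : ℝ} (ht : 0 < t) (y : Latent D) : 0 < heatKernel t y := by
  unfold heatKernel; positivity

lemma continuousOn_heatKernel :
    ContinuousOn (fun q : ℝ × Latent D => heatKernel q.1 q.2) (Ioi 0 ×ˢ univ) := by
  unfold heatKernel
  intro q hq
  have hq1 : 0 < q.1 := by simpa using hq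
  apply ContinuousAt.continuousWithinAt
  have h1 : 2 * Real.pi * q.1 ≠ 0 := by positivity
  have h2 : 2 * q.1 ≠ 0 := by positivity
  have h3 : ContinuousAt (fun q : ℝ × Latent D => 2 * Real.pi * q.1) q := by fun_prop
  have h4 : ContinuousAt (fun q : ℝ × Latent D => -‖q.2‖ ^ 2 / (2 * q.1)) q :=
    ContinuousAt.div (by fun_prop) (by fun_prop) h2
  exact (h3.rpow_const (Or.inl h1)).mul h4.rexp

lemma continuous_heatKernel {t : ℝ} : Continuous (heatKernel t : Latent D → ℝ) := by
  unfold heatKernel; fun_prop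

@[fun_prop]
lemma Measurable.heatKernel {α : Type*} [MeasurableSpace α] {f : α → ℝ} {g : α → Latent D}
    (hf : Measurable f) (hg : Measurable g) : Measurable (fun a => heatKernel (f a) (g a)) := by
  unfold DenoisingGap.heatKernel; fun_prop

/-- Gaussian decay beats quadratic growth, since `r e^{-r} ≤ 1`. The bound is uniform in `y` and in
`t` on a compact interval, so against a finite measure it dominates every differentiation under the
integral below. -/
lemma one_add_sq_mul_heatKernel_le {a b t : ℝ} (ha : 0 < a) (hat : a ≤ t) (htb : t ≤ b)
    (y : Latent D) :
    (1 + ‖y‖ ^ 2) * heatKernel t y ≤ (2 * Real.pi * a) ^ (-(D : ℝ) / 2) * (1 + 2 * b) := by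
  have ht : 0 < t := ha.trans_le hat
  have hb : 0 < b := ht.trans_le htb
  unfold heatKernel
  have h1 : (2 * Real.pi * t) ^ (-(D : ℝ) / 2) ≤ (2 * Real.pi * a) ^ (-(D : ℝ) / 2) := by
    apply Real.rpow_le_rpow_of_nonpos (by positivity) (by gcongr)
    have : (0 : ℝ) ≤ D := by positivity
    linarith
  have h2 : Real.exp (-‖y‖ ^ 2 / (2 * t)) ≤ Real.exp (-(‖y‖ ^ 2 / (2 * b))) := by
    rw [Real.exp_le_exp, neg_div]
    gcongr
  have h3 : Real.exp (-(‖y‖ ^ 2 / (2 * b))) ≤ 1 := by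
    rw [Real.exp_le_one_iff]; simp; positivity
  have h4 : ‖y‖ ^ 2 * Real.exp (-(‖y‖ ^ 2 / (2 * b))) ≤ 2 * b := by
    have h5 : ‖y‖ ^ 2 / (2 * b) ≤ Real.exp (‖y‖ ^ 2 / (2 * b)) :=
      (by linarith [Real.add_one_le_exp (‖y‖ ^ 2 / (2 * b))])
    rw [Real.exp_neg, ← div_eq_mul_inv, div_le_iff₀ (Real.exp_pos _)]
    rw [div_le_iff₀ (by positivity)] at h5
    linarith
  calc (1 + ‖y‖ ^ 2) * ((2 * Real.pi * t) ^ (-(D : ℝ) / 2) * Real.exp (-‖y‖ ^ 2 / (2 * t)))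
      ≤ (1 + ‖y‖ ^ 2) * ((2 * Real.pi * a) ^ (-(D : ℝ) / 2)
          * Real.exp (-(‖y‖ ^ 2 / (2 * b)))) := by gcongr
    _ = (2 * Real.pi * a) ^ (-(D : ℝ) / 2) * (Real.exp (-(‖y‖ ^ 2 / (2 * b)))
          + ‖y‖ ^ 2 * Real.exp (-(‖y‖ ^ 2 / (2 * b)))) := by ring
    _ ≤ _ := by gcongr

lemma hasLineDerivAt_heatKernel {t : ℝ} (ht : 0 < t) (y : Latent D) (i : Fin D) :
    HasLineDerivAt ℝ (heatKernel t) (-(y i / t) * heatKernel t y) y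
      (EuclideanSpace.single i 1) := by
  have h := ((((hasStrictFDerivAt_norm_sq y).hasFDerivAt.neg.mul_const (2 * t)⁻¹)).exp.const_mul
    ((2 * Real.pi * t) ^ (-(D : ℝ) / 2))).hasLineDerivAt (EuclideanSpace.single i 1)
  unfold HasLineDerivAt at h ⊢
  unfold heatKernel
  simp only [div_eq_mul_inv (-‖_‖ ^ 2)]
  refine h.congr_deriv ?_
  simp [EuclideanSpace.inner_single_right]
  field_simp

lemma hasDerivAt_heatKernel {t : ℝ} (ht : 0 < t) (y : Latent D) :
    HasDerivAt (fun t => heatKernel t y)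
      ((‖y‖ ^ 2 / (2 * t ^ 2) - D / (2 * t)) * heatKernel t y) t := by
  unfold heatKernel
  have h0 : HasDerivAt (fun t : ℝ => 2 * Real.pi * t) (2 * Real.pi) t := by
    simpa using (hasDerivAt_id t).const_mul (2 * Real.pi)
  have h1 := h0.rpow_const (p := -(D : ℝ) / 2) (Or.inl (by positivity))
  have h00 : HasDerivAt (fun t : ℝ => 2 * t) 2 t := by
    simpa using (hasDerivAt_id t).const_mul (2 : ℝ)
  have h2 : HasDerivAt (fun t : ℝ => Real.exp (-‖y‖ ^ 2 / (2 * t))) _ t :=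
    ((hasDerivAt_const t (-‖y‖ ^ 2)).div h00 (by positivity)).exp
  refine (h1.mul h2).congr_deriv ?_
  rw [Real.rpow_sub_one (by positivity)]
  simp only [Pi.div_apply]
  field_simp
  ring

lemma integrable_heatKernel {t : ℝ} (ht : 0 < t) : Integrable (heatKernel t : Latent D → ℝ) := by
  unfold heatKernel
  apply Integrable.const_mul
  have h := (GaussianFourier.integrable_cexp_neg_mul_sq_norm_add (V := Latent D)
    (b := ((1 / (2 * t) : ℝ) : ℂ)) (by simpa using ht) 0 0).re
  refine h.congr (ae_of_all _ fun x => ?_)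
  simp only [zero_mul, add_zero]
  rw [← Complex.ofReal_pow, ← Complex.ofReal_neg, ← Complex.ofReal_mul, ← Complex.ofReal_exp]
  simp only [RCLike.re_to_complex, Complex.ofReal_re]
  congr 1
  ring

/-- Both sides are finite measures with the same characteristic function. -/
lemma stdGaussian_eq_withDensity :
    stdGaussian (Latent D) = volume.withDensity (fun y => ENNReal.ofReal (heatKernel 1 y)) := by
  have : IsFiniteMeasure ((volume : Measure (Latent D)).withDensity
      (fun y => ENNReal.ofReal (heatKernel 1 y))) :=
    isFiniteMeasure_withDensity_ofReal (integrable_heatKernel one_pos).2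
  apply Measure.ext_of_charFun
  ext x
  rw [charFun_stdGaussian, charFun_apply,
    integral_withDensity_eq_integral_toReal_smul₀
      (continuous_heatKernel.measurable.ennreal_ofReal.aemeasurable) (by simp)]
  have h := GaussianFourier.integral_cexp_neg_mul_sq_norm_add (V := Latent D)
    (b := ((1 / 2 : ℝ) : ℂ)) (by simp) Complex.I x
  have h2 : ∀ v : Latent D, (ENNReal.ofReal (heatKernel 1 v)).toReal •
      Complex.exp ((inner ℝ v x : ℝ) * Complex.I) = (((2 * Real.pi) ^ (-(D : ℝ) / 2) : ℝ) : ℂ) *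
      Complex.exp (-((1 / 2 : ℝ) : ℂ) * (‖v‖ : ℂ) ^ 2 + Complex.I * (inner ℝ x v : ℝ)) := by
    intro v
    rw [ENNReal.toReal_ofReal (heatKernel_pos one_pos _).le, heatKernel]
    rw [real_inner_comm, Complex.exp_add, Complex.real_smul]
    push_cast
    simp only [mul_one]
    rw [← mul_assoc, mul_comm (Complex.I)]
    congr 3
    ring
  simp_rw [h2]
  rw [integral_const_mul, h]
  have h3 : ((Real.pi : ℂ) / ((1 / 2 : ℝ) : ℂ)) ^ ((Module.finrank ℝ (Latent D) : ℂ) / 2)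
      = (((2 * Real.pi) ^ ((D : ℝ) / 2) : ℝ) : ℂ) := by
    rw [Complex.ofReal_cpow (by positivity)]
    simp
    ring_nf
  rw [h3, ← mul_assoc, ← Complex.ofReal_mul, ← Real.rpow_add (by positivity)]
  rw [show -(D : ℝ) / 2 + D / 2 = 0 by ring, Real.rpow_zero, Complex.ofReal_one, one_mul,
    Complex.I_sq]
  congr 1
  push_cast
  ring

lemma lintegral_eq_lintegral_comp_smul (f : Latent D → ℝ≥0∞) (hf : Measurable f) {t : ℝ}
    (ht : 0 < t) : ∫⁻ y, f y = ∫⁻ x, ENNReal.ofReal (√t ^ D) * f (√t • x) := by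
  have hs : 0 < √t := Real.sqrt_pos.2 ht
  rw [lintegral_const_mul _ (f := fun x => f (√t • x)) (hf.comp (by fun_prop)),
    ← lintegral_map (f := f) (g := fun x => √t • x) hf (by fun_prop),
    Measure.map_addHaar_smul (volume : Measure (Latent D)) hs.ne', lintegral_smul_measure]
  simp only [finrank_euclideanSpace, Fintype.card_fin, smul_eq_mul]
  rw [← mul_assoc, ← ENNReal.ofReal_mul (by positivity), abs_of_pos (by positivity),
    mul_inv_cancel₀ (by positivity)]
  simp

/-- Parabolic scaling: space scales as `√t`, which reduces every time to time one. -/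
lemma pow_mul_heatKernel_smul {t : ℝ} (ht : 0 < t) (x : Latent D) :
    √t ^ D * heatKernel t (√t • x) = heatKernel 1 x := by
  have hs : 0 < √t := Real.sqrt_pos.2 ht
  unfold heatKernel
  rw [norm_smul, mul_pow, Real.norm_of_nonneg hs.le, Real.sq_sqrt ht.le, ← mul_assoc]
  congr 1
  · rw [mul_one, Real.mul_rpow (x := 2 * Real.pi) (by positivity) ht.le, mul_left_comm,
      Real.sqrt_eq_rpow, ← Real.rpow_natCast, ← Real.rpow_mul ht.le, ← Real.rpow_add ht]
    rw [show 1 / 2 * (D : ℝ) + -(D : ℝ) / 2 = 0 by ring]; simp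
  · congr 1; field_simp

lemma lintegral_stdGaussian (F : Latent D → ℝ≥0∞) (hF : Measurable F) {t : ℝ} (ht : 0 < t)
    (z : Latent D) :
    ∫⁻ ε, F (z + √t • ε) ∂(stdGaussian (Latent D)) =
      ∫⁻ y, F y * ENNReal.ofReal (heatKernel t (y - z)) := by
  rw [stdGaussian_eq_withDensity, lintegral_withDensity_eq_lintegral_mul _
    continuous_heatKernel.measurable.ennreal_ofReal
    (g := fun ε => F (z + √t • ε)) (hF.comp (by fun_prop))]
  rw [← lintegral_add_right_eq_self (fun y => F y * ENNReal.ofReal (heatKernel t (y - z))) z]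
  rw [lintegral_eq_lintegral_comp_smul (fun y => F (y + z) *
    ENNReal.ofReal (heatKernel t (y + z - z))) (by fun_prop) ht]
  refine lintegral_congr fun x => ?_
  simp only [Pi.mul_apply, add_sub_cancel_right]
  rw [mul_left_comm, ← ENNReal.ofReal_mul (by positivity), add_comm z, mul_comm,
    pow_mul_heatKernel_smul ht]

lemma lintegral_heatKernel {t : ℝ} (ht : 0 < t) (z : Latent D) :
    ∫⁻ y : Latent D, ENNReal.ofReal (heatKernel t (y - z)) = 1 := by
  have := lintegral_stdGaussian (D := D) (fun _ => 1) (by fun_prop) ht z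
  simpa using this.symm

attribute [irreducible] heatKernel

end

/-! ### The heat flow of a finite measure and the heat equation -/

section

variable {D : ℕ}

/-- A continuous weight of at most quadratic growth. -/
structure QuadWeight (w : Latent D → ℝ) : Prop where
  continuous : Continuous w
  bound : ∃ A, ∀ y, |w y| ≤ A * (1 + ‖y‖ ^ 2)

lemma abs_apply_le_one_add_sq (y : Latent D) (i : Fin D) : |y i| ≤ 1 + ‖y‖ ^ 2 := by
  have h := PiLp.norm_apply_le y i
  rw [Real.norm_eq_abs] at h
  nlinarith [sq_nonneg (‖y‖ - 1), norm_nonneg y]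

lemma QuadWeight.const (c : ℝ) : QuadWeight (fun _ : Latent D => c) :=
  ⟨continuous_const, |c|, fun y => by
    have := mul_nonneg (abs_nonneg c) (sq_nonneg (norm y))
    linarith⟩

lemma QuadWeight.apply (i : Fin D) : QuadWeight (fun y : Latent D => y i) :=
  ⟨by fun_prop, 1, fun y => by simpa using abs_apply_le_one_add_sq y i⟩

lemma QuadWeight.apply_sq (i : Fin D) : QuadWeight (fun y : Latent D => y i ^ 2) :=
  ⟨by fun_prop, 1, fun y => by
    have h := PiLp.norm_apply_le y i
    rw [Real.norm_eq_abs] at h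
    rw [abs_pow, one_mul]
    nlinarith [abs_nonneg (y i), norm_nonneg y]⟩

lemma QuadWeight.norm_sq : QuadWeight (fun y : Latent D => ‖y‖ ^ 2) :=
  ⟨by fun_prop, 1, fun y => by rw [abs_of_nonneg (by positivity)]; linarith⟩

lemma QuadWeight.const_mul {w : Latent D → ℝ} (hw : QuadWeight w) (c : ℝ) :
    QuadWeight (fun y => c * w y) := by
  obtain ⟨A, hA⟩ := hw.bound
  refine ⟨hw.continuous.const_mul c, |c| * A, fun y => ?_⟩
  rw [abs_mul, mul_assoc]
  gcongr
  exact hA y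

lemma QuadWeight.add {w w' : Latent D → ℝ} (hw : QuadWeight w) (hw' : QuadWeight w') :
    QuadWeight (fun y => w y + w' y) := by
  obtain ⟨A, hA⟩ := hw.bound
  obtain ⟨B, hB⟩ := hw'.bound
  refine ⟨hw.continuous.add hw'.continuous, A + B, fun y => ?_⟩
  rw [add_mul]
  exact (abs_add_le _ _).trans (add_le_add (hA y) (hB y))

lemma QuadWeight.exists_bound {w : Latent D → ℝ} (hw : QuadWeight w) {a b : ℝ} (ha : 0 < a) :
    ∃ C, ∀ t ∈ Icc a b, ∀ y, |w y * heatKernel t y| ≤ C := by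
  obtain ⟨A, hA⟩ := hw.bound
  refine ⟨A * ((2 * Real.pi * a) ^ (-(D : ℝ) / 2) * (1 + 2 * b)), fun t ht y => ?_⟩
  have hA0 : 0 ≤ A := by
    have := (abs_nonneg _).trans (hA 0)
    simpa using this
  have hG := (heatKernel_pos (ha.trans_le ht.1) y).le
  rw [abs_mul, abs_of_nonneg hG]
  calc |w y| * heatKernel t y ≤ A * (1 + ‖y‖ ^ 2) * heatKernel t y := by gcongr; exact hA y
    _ = A * ((1 + ‖y‖ ^ 2) * heatKernel t y) := by ring
    _ ≤ _ := mul_le_mul_of_nonneg_left (one_add_sq_mul_heatKernel_le ha ht.1 ht.2 y) hA0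

/-- The function `x ↦ ∫ w(x - z) G_t(x - z) μ(dz)`. -/
noncomputable def heatMoment (μ : Measure (Latent D)) (w : Latent D → ℝ) (t : ℝ) (x : Latent D) :
    ℝ :=
  ∫ z, w (x - z) * heatKernel t (x - z) ∂μ

variable {μ : Measure (Latent D)} [IsFiniteMeasure μ] {w : Latent D → ℝ}

omit [IsFiniteMeasure μ] in
lemma QuadWeight.aestronglyMeasurable (hw : QuadWeight w) (t : ℝ) (x : Latent D) :
    AEStronglyMeasurable (fun z => w (x - z) * heatKernel t (x - z)) μ := by
  have h1 : Continuous (fun z => w (x - z)) := hw.continuous.comp (by fun_prop)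
  have h2 : Continuous (fun z => heatKernel t (x - z)) := continuous_heatKernel.comp (by fun_prop)
  exact (h1.mul h2).aestronglyMeasurable

lemma QuadWeight.integrable (hw : QuadWeight w) {t : ℝ} (ht : 0 < t) (x : Latent D) :
    Integrable (fun z => w (x - z) * heatKernel t (x - z)) μ := by
  obtain ⟨C, hC⟩ := hw.exists_bound (b := t) ht
  refine Integrable.of_bound (C := C) ?_ (ae_of_all _ fun z => ?_)
  · exact hw.aestronglyMeasurable t x
  · simpa using hC t ⟨le_rfl, le_rfl⟩ (x - z)

lemma QuadWeight.continuousOn_heatMoment (hw : QuadWeight w) :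
    ContinuousOn (fun q : ℝ × Latent D => heatMoment μ w q.1 q.2) (Ioi 0 ×ˢ univ) := by
  intro q hq
  have hq1 : 0 < q.1 := by simpa using hq
  apply ContinuousAt.continuousWithinAt
  obtain ⟨C, hC⟩ := hw.exists_bound (a := q.1 / 2) (b := 2 * q.1) (by positivity)
  have hnear : ∀ᶠ r : ℝ × Latent D in 𝓝 q, r.1 ∈ Icc (q.1 / 2) (2 * q.1) :=
    (continuous_fst.tendsto q).eventually
      (Icc_mem_nhds (by linarith) (by linarith))
  unfold heatMoment
  refine continuousAt_of_dominated (bound := fun _ => C) ?_ ?_ (integrable_const _) ?_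
  · exact Eventually.of_forall fun r => hw.aestronglyMeasurable r.1 r.2
  · filter_upwards [hnear] with r hr
    exact ae_of_all _ fun z => by simpa using hC r.1 hr (r.2 - z)
  · refine ae_of_all _ fun z => ContinuousAt.mul ?_ ?_
    · exact (hw.continuous.comp (by fun_prop)).continuousAt
    · have h1 : ContinuousAt (fun q : ℝ × Latent D => heatKernel q.1 q.2) (q.1, q.2 - z) :=
        continuousOn_heatKernel.continuousAt (prod_mem_nhds (Ioi_mem_nhds hq1) univ_mem)
      exact ContinuousAt.comp (f := fun r : ℝ × Latent D => (r.1, r.2 - z)) h1 (by fun_prop)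

/-- Differentiation under the integral. The majorant is a constant valid along the whole line, so no
neighbourhood has to be chosen; the pointwise derivative is left to the caller, and serves for both
first and second derivatives. -/
lemma hasLineDerivAt_heatMoment {w' : Latent D → ℝ} (hw : QuadWeight w) (hw' : QuadWeight w')
    {t : ℝ} (ht : 0 < t) {v : Latent D}
    (h : ∀ y, HasLineDerivAt ℝ (fun y => w y * heatKernel t y) (w' y * heatKernel t y) y v)
    (x : Latent D) : HasLineDerivAt ℝ (heatMoment μ w t) (heatMoment μ w' t x) x v := by
  obtain ⟨C, hC⟩ := hw'.exists_bound (b := t) ht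
  have key := hasDerivAt_integral_of_dominated_loc_of_deriv_le (μ := μ) (s := univ) (x₀ := (0 : ℝ))
    (F := fun r z => w (x + r • v - z) * heatKernel t (x + r • v - z))
    (F' := fun r z => w' (x + r • v - z) * heatKernel t (x + r • v - z))
    (bound := fun _ => C) univ_mem
    (Eventually.of_forall fun r => hw.aestronglyMeasurable t _)
    (hw.integrable ht _)
    (hw'.aestronglyMeasurable t _)
    (ae_of_all _ fun z r _ => by simpa using hC t ⟨le_rfl, le_rfl⟩ (x + r • v - z))
    (integrable_const _)
    -- A line derivative is a derivative at parameter `0`; recentring at `x + r • v - z` by `s ↦ s -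
    -- r` moves it to parameter `r`.
    (ae_of_all _ fun z r _ => by
      have h1 := h (x + r • v - z)
      unfold HasLineDerivAt at h1
      have h2 : HasDerivAt (fun s : ℝ => s - r) 1 r := (hasDerivAt_id r).sub_const r
      have h3 := HasDerivAt.scomp (h := fun s : ℝ => s - r) r (by simpa using h1) h2
      simp only [one_smul] at h3
      refine h3.congr_of_eventuallyEq (Eventually.of_forall fun s => ?_)
      simp only [Function.comp]
      have : x + r • v - z + (s - r) • v = x + s • v - z := by rw [sub_smul]; abel
      rw [this])
  have := key.2
  simp only [zero_smul, add_zero] at this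
  exact this

lemma hasDerivAt_heatMoment {t : ℝ} (ht : 0 < t) (x : Latent D) :
    HasDerivAt (fun t => heatMoment μ (fun _ => 1) t x)
      (heatMoment μ (fun y => ‖y‖ ^ 2 / (2 * t ^ 2) - D / (2 * t)) t x) t := by
  obtain ⟨C₁, hC₁⟩ := (QuadWeight.norm_sq (D := D)).exists_bound (a := t / 2) (b := 2 * t)
    (by positivity)
  obtain ⟨C₂, hC₂⟩ := (QuadWeight.const (D := D) 1).exists_bound (a := t / 2) (b := 2 * t)
    (by positivity)
  have key := hasDerivAt_integral_of_dominated_loc_of_deriv_le (μ := μ)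
    (s := Icc (t / 2) (2 * t)) (x₀ := t)
    (F := fun t z => 1 * heatKernel t (x - z))
    (F' := fun t z => (‖x - z‖ ^ 2 / (2 * t ^ 2) - D / (2 * t)) * heatKernel t (x - z))
    (bound := fun _ => C₁ / (2 * (t / 2) ^ 2) + D / (2 * (t / 2)) * C₂)
    (Icc_mem_nhds (by linarith) (by linarith))
    (Eventually.of_forall fun r => (QuadWeight.const 1).aestronglyMeasurable r x)
    ((QuadWeight.const (D := D) 1).integrable ht _)
    (Continuous.aestronglyMeasurable (Continuous.mul (by fun_prop)
      (continuous_heatKernel.comp (continuous_const.sub continuous_id))))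
    (ae_of_all _ fun z r hr => by
      have hr0 : 0 < r := lt_of_lt_of_le (by positivity) hr.1
      have h1 := hC₁ r hr (x - z)
      have h2 := hC₂ r hr (x - z)
      rw [abs_of_nonneg (mul_nonneg (by positivity) (heatKernel_pos hr0 _).le)] at h1 h2
      rw [one_mul] at h2
      have hG := (heatKernel_pos hr0 (x - z)).le
      have h3 : ‖x - z‖ ^ 2 * heatKernel r (x - z) / (2 * r ^ 2) ≤ C₁ / (2 * (t / 2) ^ 2) := by
        have : 0 ≤ ‖x - z‖ ^ 2 * heatKernel r (x - z) := by positivity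
        have := hr.1
        gcongr
        linarith
      have h4 : D / (2 * r) * heatKernel r (x - z) ≤ D / (2 * (t / 2)) * C₂ := by
        have := hr.1
        gcongr
      rw [sub_mul, Real.norm_eq_abs]
      refine (abs_sub _ _).trans ?_
      rw [abs_of_nonneg (by positivity), abs_of_nonneg (by positivity)]
      rw [div_mul_eq_mul_div]
      exact add_le_add h3 h4)
    (integrable_const _)
    (ae_of_all _ fun z r hr => by
      have hr0 : 0 < r := lt_of_lt_of_le (by positivity) hr.1
      simpa using hasDerivAt_heatKernel hr0 (x - z))
  exact key.2

lemma heatMoment_add {w' : Latent D → ℝ} (hw : QuadWeight w) (hw' : QuadWeight w') {t : ℝ}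
    (ht : 0 < t) (x : Latent D) :
    heatMoment μ (fun y => w y + w' y) t x = heatMoment μ w t x + heatMoment μ w' t x := by
  unfold heatMoment
  rw [← integral_add (hw.integrable ht x) (hw'.integrable ht x)]
  simp_rw [add_mul]

omit [IsFiniteMeasure μ] in
lemma heatMoment_const_mul (c : ℝ) (t : ℝ) (x : Latent D) :
    heatMoment μ (fun y => c * w y) t x = c * heatMoment μ w t x := by
  unfold heatMoment
  rw [← integral_const_mul]
  simp_rw [mul_assoc]

/-- The density of `μ * N(0, t I)`. -/
noncomputable def heatFlow (μ : Measure (Latent D)) (t : ℝ) (x : Latent D) : ℝ :=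
  heatMoment μ (fun _ => 1) t x

/-- The `i`-th partial derivative of `heatFlow μ t`. -/
noncomputable def heatGrad (μ : Measure (Latent D)) (t : ℝ) (i : Fin D) (x : Latent D) : ℝ :=
  -(1 / t) * heatMoment μ (fun y => y i) t x

/-- The `i`-th pure second partial derivative of `heatFlow μ t`. -/
noncomputable def heatHess (μ : Measure (Latent D)) (t : ℝ) (i : Fin D) (x : Latent D) : ℝ :=
  1 / t ^ 2 * heatMoment μ (fun y => y i ^ 2) t x - 1 / t * heatFlow μ t x

lemma hasLineDerivAt_heatFlow {t : ℝ} (ht : 0 < t) (i : Fin D) (x : Latent D) :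
    HasLineDerivAt ℝ (heatFlow μ t) (heatGrad μ t i x) x (EuclideanSpace.single i 1) := by
  unfold heatFlow heatGrad
  rw [← heatMoment_const_mul]
  refine hasLineDerivAt_heatMoment (QuadWeight.const 1) ((QuadWeight.apply i).const_mul _) ht
    (fun y => ?_) x
  have := hasLineDerivAt_heatKernel ht y i
  simp only [one_mul]
  convert this using 1
  ring

lemma hasLineDerivAt_heatGrad {t : ℝ} (ht : 0 < t) (i : Fin D) (x : Latent D) :
    HasLineDerivAt ℝ (heatGrad μ t i) (heatHess μ t i x) x (EuclideanSpace.single i 1) := by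
  have h : HasLineDerivAt ℝ (heatMoment μ (fun y => -(1 / t) * y i) t)
      (heatMoment μ (fun y => 1 / t ^ 2 * y i ^ 2 + -(1 / t)) t x) x
      (EuclideanSpace.single i 1) := by
    refine hasLineDerivAt_heatMoment ((QuadWeight.apply i).const_mul _)
      (((QuadWeight.apply_sq i).const_mul _).add (QuadWeight.const _)) ht (fun y => ?_) x
    have h1 := hasLineDerivAt_heatKernel ht y i
    unfold HasLineDerivAt at h1 ⊢
    have h2 : HasDerivAt (fun r : ℝ => -(1 / t) * (y + r • EuclideanSpace.single i (1 : ℝ)) i)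
        (-(1 / t)) 0 := by
      have : (fun r : ℝ => -(1 / t) * (y + r • EuclideanSpace.single i (1 : ℝ)) i) =
          fun r => -(1 / t) * (y i + r) := by ext r; simp
      rw [this]
      simpa using ((hasDerivAt_id (0 : ℝ)).const_add (y i)).const_mul (-(1 / t))
    refine (h2.mul h1).congr_deriv ?_
    simp
    field_simp
    ring
  have e1 : heatMoment μ (fun y => -(1 / t) * y i) t = heatGrad μ t i := by
    ext x; rw [heatMoment_const_mul]; rfl
  rw [e1, heatMoment_add ((QuadWeight.apply_sq i).const_mul _) (QuadWeight.const _) ht,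
    heatMoment_const_mul] at h
  convert h using 1
  unfold heatHess heatFlow
  rw [show (fun _ : Latent D => -(1 / t)) = fun _ => -(1 / t) * 1 by simp, heatMoment_const_mul]
  ring

/-- The time derivative brings down the weight `‖y‖²/(2t²) - D/(2t)`, which is half the sum over `i`
of the weights `y_i²/t² - 1/t` of the second derivatives. -/
lemma hasDerivAt_heatFlow {t : ℝ} (ht : 0 < t) (x : Latent D) :
    HasDerivAt (fun t => heatFlow μ t x) (1 / 2 * ∑ i, heatHess μ t i x) t := by
  refine (hasDerivAt_heatMoment ht x).congr_deriv ?_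
  have e : (fun y : Latent D => ‖y‖ ^ 2 / (2 * t ^ 2) - D / (2 * t)) =
      fun y => 1 / (2 * t ^ 2) * ‖y‖ ^ 2 + -(D / (2 * t)) * 1 := by
    ext y; ring
  rw [e, heatMoment_add (QuadWeight.norm_sq.const_mul _) ((QuadWeight.const 1).const_mul _) ht,
    heatMoment_const_mul, heatMoment_const_mul]
  have e2 : heatMoment μ (fun y => ‖y‖ ^ 2) t x = ∑ i, heatMoment μ (fun y => y i ^ 2) t x := by
    unfold heatMoment
    rw [← integral_finsetSum _ fun i _ => (QuadWeight.apply_sq i).integrable ht x]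
    congr 1
    ext z
    simp only [EuclideanSpace.real_norm_sq_eq, Finset.sum_mul]
  unfold heatHess
  rw [e2, Finset.sum_sub_distrib, ← Finset.mul_sum]
  simp only [Finset.sum_const, Finset.card_univ, Fintype.card_fin, nsmul_eq_mul]
  unfold heatFlow
  field_simp
  ring

lemma heatFlow_pos [NeZero μ] {t : ℝ} (ht : 0 < t) (x : Latent D) : 0 < heatFlow μ t x := by
  unfold heatFlow heatMoment
  rw [integral_pos_iff_support_of_nonneg]
  · have : Function.support (fun z => 1 * heatKernel t (x - z)) = univ := by
      ext z; simp [(heatKernel_pos ht (x - z)).ne']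
    rw [this]
    exact (NeZero.ne (μ univ)).bot_lt
  · exact fun z => by simpa using (heatKernel_pos ht (x - z)).le
  · exact (QuadWeight.const 1).integrable ht x

lemma continuousOn_heatFlow :
    ContinuousOn (fun q : ℝ × Latent D => heatFlow μ q.1 q.2) (Ioi 0 ×ˢ univ) :=
  (QuadWeight.const 1).continuousOn_heatMoment

lemma continuousOn_heatGrad (i : Fin D) :
    ContinuousOn (fun q : ℝ × Latent D => heatGrad μ q.1 i q.2) (Ioi 0 ×ˢ univ) := by
  unfold heatGrad
  refine ContinuousOn.mul (ContinuousOn.neg (continuousOn_const.div continuousOn_fst ?_))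
    (QuadWeight.apply i).continuousOn_heatMoment
  rintro ⟨t, x⟩ h
  exact (show 0 < t by simpa using h).ne'

lemma continuousOn_heatHess (i : Fin D) :
    ContinuousOn (fun q : ℝ × Latent D => heatHess μ q.1 i q.2) (Ioi 0 ×ˢ univ) := by
  have h0 : ∀ q ∈ (Ioi 0 ×ˢ univ : Set (ℝ × Latent D)), q.1 ≠ 0 := by
    rintro ⟨t, x⟩ h
    exact (show 0 < t by simpa using h).ne'
  unfold heatHess
  exact ((continuousOn_const.div (continuousOn_fst.pow 2) fun q hq => pow_ne_zero 2 (h0 q hq)).mul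
    (QuadWeight.apply_sq i).continuousOn_heatMoment).sub
    ((continuousOn_const.div continuousOn_fst h0).mul continuousOn_heatFlow)

end

/-! ### Cutoffs and the localized dissipation identity -/

section

open scoped ContDiff

variable {D : ℕ}

/-- The Laplacian as the sum of the pure second partial derivatives. -/
noncomputable def coordLaplacian (χ : Latent D → ℝ) (x : Latent D) : ℝ :=
  ∑ i, fderiv ℝ (fun y => fderiv ℝ χ y (EuclideanSpace.single i 1)) x (EuclideanSpace.single i 1)

lemma contDiff_fderiv_apply {χ : Latent D → ℝ} (hχ : ContDiff ℝ ∞ χ) (v : Latent D) :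
    ContDiff ℝ ∞ (fun y => fderiv ℝ χ y v) :=
  (hχ.fderiv_right (m := ∞) (by simp)).clm_apply contDiff_const

lemma continuous_coordLaplacian {χ : Latent D → ℝ} (hχ : ContDiff ℝ ∞ χ) :
    Continuous (coordLaplacian χ) :=
  continuous_finsetSum _ fun _ _ =>
    (contDiff_fderiv_apply (contDiff_fderiv_apply hχ _) _).continuous

lemma hasCompactSupport_coordLaplacian {χ : Latent D → ℝ} (hχ : HasCompactSupport χ) :
    HasCompactSupport (coordLaplacian χ) := by
  refine HasCompactSupport.intro hχ fun x hx => Finset.sum_eq_zero fun i _ => ?_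
  have h1 : tsupport (fun y => fderiv ℝ χ y (EuclideanSpace.single i 1)) ⊆ tsupport χ :=
    tsupport_fderiv_apply_subset ℝ _
  have h2 : x ∉ tsupport (fun y => fderiv ℝ χ y (EuclideanSpace.single i 1)) :=
    fun h => hx (h1 h)
  have h3 := notMem_tsupport_iff_eventuallyEq.1 h2
  rw [h3.fderiv_eq]
  simp

/-- Integration by parts in which the compact support of `χ` supplies all integrability, so `f`
needs no decay. -/
lemma integral_mul_eq_neg_of_hasLineDerivAt {χ f f' : Latent D → ℝ} {v : Latent D}
    (hχ : ContDiff ℝ ∞ χ) (hχc : HasCompactSupport χ) (hf : Continuous f) (hf' : Continuous f')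
    (h : ∀ x, HasLineDerivAt ℝ f (f' x) x v) :
    ∫ x, χ x * f' x = -∫ x, fderiv ℝ χ x v * f x := by
  have h1 : Continuous (fun x => fderiv ℝ χ x v) := (contDiff_fderiv_apply hχ v).continuous
  have := integral_bilinear_hasLineDerivAt_right_eq_neg_left_of_integrable
    (μ := (volume : Measure (Latent D))) (f := χ) (f' := fun x => fderiv ℝ χ x v) (g := f)
    (g' := f') (v := v) (B := ContinuousLinearMap.mul ℝ ℝ)
    ((h1.mul hf).integrable_of_hasCompactSupport ((hχc.fderiv_apply ℝ v).mul_right))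
    ((hχ.continuous.mul hf').integrable_of_hasCompactSupport hχc.mul_right)
    ((hχ.continuous.mul hf).integrable_of_hasCompactSupport hχc.mul_right)
    (fun x _ => ((hχ.differentiable (by simp)).differentiableAt.hasFDerivAt).hasLineDerivAt v)
    (fun x _ => h x)
  simpa using this

lemma continuous_section {f : ℝ → Latent D → ℝ}
    (hf : ContinuousOn (fun q : ℝ × Latent D => f q.1 q.2) (Ioi 0 ×ˢ univ)) {t : ℝ} (ht : 0 < t) :
    Continuous (f t) := by
  rw [← continuousOn_univ]
  exact hf.comp (f := fun x => (t, x)) (by fun_prop) fun x _ => by simpa using ht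

lemma continuousOn_section {f : ℝ → Latent D → ℝ}
    (hf : ContinuousOn (fun q : ℝ × Latent D => f q.1 q.2) (Ioi 0 ×ˢ univ)) (x : Latent D) :
    ContinuousOn (fun t => f t x) (Ioi 0) :=
  hf.comp (f := fun t => (t, x)) (by fun_prop) fun t ht => by simpa using ht

lemma integrable_mul_cutoff {f : ℝ → Latent D → ℝ}
    (hf : ContinuousOn (fun q : ℝ × Latent D => f q.1 q.2) (Ioi 0 ×ˢ univ))
    {χ : Latent D → ℝ} (hχ : Continuous χ) (hχc : HasCompactSupport χ) {a b : ℝ} (ha : 0 < a) :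
    Integrable (fun q : ℝ × Latent D => χ q.2 * f q.1 q.2)
      ((volume.restrict (Ioc a b)).prod volume) := by
  have hK : IsCompact (Icc a b ×ˢ tsupport χ) := isCompact_Icc.prod hχc
  have h1 : IntegrableOn (fun q : ℝ × Latent D => χ q.2 * f q.1 q.2) (Icc a b ×ˢ tsupport χ)
      (volume.prod volume) := by
    refine ContinuousOn.integrableOn_compact hK ?_
    refine (hχ.comp continuous_snd).continuousOn.mul (hf.mono ?_)
    rintro ⟨t, x⟩ ⟨h, -⟩
    exact ⟨ha.trans_le h.1, trivial⟩
  have h2 : IntegrableOn (fun q : ℝ × Latent D => χ q.2 * f q.1 q.2) (Ioc a b ×ˢ univ)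
      (volume.prod volume) := by
    refine h1.of_forall_sdiff_eq_zero (measurableSet_Ioc.prod MeasurableSet.univ) ?_
    rintro ⟨t, x⟩ ⟨⟨h, -⟩, hn⟩
    have : x ∉ tsupport χ := fun hx => hn ⟨Ioc_subset_Icc_self h, hx⟩
    simp [image_eq_zero_of_notMem_tsupport this]
  rwa [IntegrableOn, ← Measure.prod_restrict, Measure.restrict_univ] at h2

/-- `H` solves `∂_t H = ½ Δ H - ½ K` for `t > 0`; `H₁` and `H₂` are its first and its pure second
partial derivatives in space. -/
structure Dissipation (H : ℝ → Latent D → ℝ) (H₁ H₂ : ℝ → Fin D → Latent D → ℝ)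
    (K : ℝ → Latent D → ℝ) : Prop where
  cont : ContinuousOn (fun q : ℝ × Latent D => H q.1 q.2) (Ioi 0 ×ˢ univ)
  cont₁ (i : Fin D) : ContinuousOn (fun q : ℝ × Latent D => H₁ q.1 i q.2) (Ioi 0 ×ˢ univ)
  cont₂ (i : Fin D) : ContinuousOn (fun q : ℝ × Latent D => H₂ q.1 i q.2) (Ioi 0 ×ˢ univ)
  contK : ContinuousOn (fun q : ℝ × Latent D => K q.1 q.2) (Ioi 0 ×ˢ univ)
  hasLineDerivAt {t : ℝ} (ht : 0 < t) (i : Fin D) (x : Latent D) :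
    HasLineDerivAt ℝ (H t) (H₁ t i x) x (EuclideanSpace.single i 1)
  hasLineDerivAt₁ {t : ℝ} (ht : 0 < t) (i : Fin D) (x : Latent D) :
    HasLineDerivAt ℝ (H₁ t i) (H₂ t i x) x (EuclideanSpace.single i 1)
  hasDerivAt {t : ℝ} (ht : 0 < t) (x : Latent D) :
    HasDerivAt (fun t => H t x) (1 / 2 * ∑ i, H₂ t i x - 1 / 2 * K t x) t

/-- The dissipation of `∫ χ H_t` for a test function `χ`. -/
lemma Dissipation.integral_cutoff_sub {H K : ℝ → Latent D → ℝ} {H₁ H₂ : ℝ → Fin D → Latent D → ℝ}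
    (h : Dissipation H H₁ H₂ K)
    {χ : Latent D → ℝ} (hχ : ContDiff ℝ ∞ χ) (hχc : HasCompactSupport χ) {a b : ℝ} (ha : 0 < a)
    (hab : a ≤ b) :
    (∫ x, χ x * H b x) - ∫ x, χ x * H a x =
      (1 / 2 * ∫ t in a..b, ∫ x, coordLaplacian χ x * H t x)
        - 1 / 2 * ∫ t in a..b, ∫ x, χ x * K t x := by
  obtain ⟨hH, hH₁, hH₂, hK, h1, h2, ht⟩ := h
  have hb : 0 < b := ha.trans_le hab
  set g : ℝ → Latent D → ℝ := fun t x => 1 / 2 * ∑ i, H₂ t i x - 1 / 2 * K t x with hg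
  have hgc : ContinuousOn (fun q : ℝ × Latent D => g q.1 q.2) (Ioi 0 ×ˢ univ) :=
    (continuousOn_const.mul (continuousOn_finsetSum _ fun i _ => hH₂ i)).sub
      (continuousOn_const.mul hK)
  have hsub : Icc a b ⊆ Ioi 0 := fun t h => ha.trans_le h.1
  -- The fundamental theorem of calculus in time at fixed `x`; the integrals in `t` and `x` are
  -- exchanged at the end.
  have e1 : ∀ x, χ x * H b x - χ x * H a x = ∫ t in Ioc a b, χ x * g t x := by
    intro x
    rw [integral_const_mul, ← intervalIntegral.integral_of_le hab,
      intervalIntegral.integral_eq_sub_of_hasDerivAt (f := fun t => H t x)]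
    · ring
    · intro t h
      rw [uIcc_of_le hab] at h
      exact ht (hsub h) x
    · apply ContinuousOn.intervalIntegrable
      rw [uIcc_of_le hab]
      exact (continuousOn_section hgc x).mono hsub
  have hi : ∀ t, 0 < t → ∀ f : ℝ → Latent D → ℝ,
      ContinuousOn (fun q : ℝ × Latent D => f q.1 q.2) (Ioi 0 ×ˢ univ) →
      Integrable (fun x => χ x * f t x) := fun t h f hf =>
    (hχ.continuous.mul (continuous_section hf h)).integrable_of_hasCompactSupport hχc.mul_right
  have e2 : ∀ t, 0 < t → ∫ x, χ x * g t x =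
      1 / 2 * (∫ x, coordLaplacian χ x * H t x) - 1 / 2 * ∫ x, χ x * K t x := by
    intro t h
    -- Two integrations by parts move both derivatives onto `χ`.
    have e3 : ∀ i, ∫ x, χ x * H₂ t i x = ∫ x, fderiv ℝ (fun y => fderiv ℝ χ y
        (EuclideanSpace.single i 1)) x (EuclideanSpace.single i 1) * H t x := by
      intro i
      rw [integral_mul_eq_neg_of_hasLineDerivAt hχ hχc (continuous_section (f := fun t => H₁ t i)
        (hH₁ i) h) (continuous_section (f := fun t => H₂ t i) (hH₂ i) h) (h2 h i),
        integral_mul_eq_neg_of_hasLineDerivAt (contDiff_fderiv_apply hχ _)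
        (hχc.fderiv_apply ℝ _) (continuous_section hH h)
        (continuous_section (f := fun t => H₁ t i) (hH₁ i) h) (h1 h i), neg_neg]
    have e4 : ∀ x, χ x * g t x = 1 / 2 * (∑ i, χ x * H₂ t i x) - 1 / 2 * (χ x * K t x) := by
      intro x; rw [← Finset.mul_sum]; simp only [hg]; ring
    simp_rw [e4]
    rw [integral_sub, integral_const_mul, integral_const_mul, integral_finsetSum]
    · simp_rw [e3, coordLaplacian, Finset.sum_mul]
      rw [integral_finsetSum]
      intro i _
      have hc := contDiff_fderiv_apply (contDiff_fderiv_apply hχ (EuclideanSpace.single i 1))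
        (EuclideanSpace.single i 1)
      exact (hc.continuous.mul (continuous_section hH h)).integrable_of_hasCompactSupport
        (((hχc.fderiv_apply ℝ _).fderiv_apply ℝ _).mul_right)
    · exact fun i _ => hi t h (fun t => H₂ t i) (hH₂ i)
    · exact (integrable_finsetSum _ fun i _ => hi t h (fun t => H₂ t i) (hH₂ i)).const_mul _
    · exact (hi t h K hK).const_mul _
  have hΔc := continuous_coordLaplacian hχ
  have hΔs := hasCompactSupport_coordLaplacian hχc
  rw [← integral_sub (hi b hb H hH) (hi a ha H hH)]
  simp_rw [e1]
  rw [integral_integral_swap (f := fun x t => χ x * g t x)]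
  · rw [intervalIntegral.integral_of_le hab, intervalIntegral.integral_of_le hab,
      ← integral_const_mul, ← integral_const_mul, ← integral_sub]
    · refine setIntegral_congr_fun measurableSet_Ioc fun t h => ?_
      exact e2 t (ha.trans h.1)
    · exact (integrable_mul_cutoff hH hΔc hΔs ha).integral_prod_left.const_mul _
    · exact (integrable_mul_cutoff hK hχ.continuous hχc ha).integral_prod_left.const_mul _
  · exact (integrable_mul_cutoff hgc hχ.continuous hχc ha).swap

/-- Dilations by `n + 1` of one bump function; each of two derivatives gains a factor `1/(n + 1)`.
-/
lemma exists_cutoff (D : ℕ) : ∃ C : ℝ, ∃ χ : ℕ → Latent D → ℝ, ∀ n,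
    ContDiff ℝ ∞ (χ n) ∧ HasCompactSupport (χ n) ∧ (∀ x, 0 ≤ χ n x ∧ χ n x ≤ 1) ∧
    (∀ x, |coordLaplacian (χ n) x| ≤ C * (((n : ℝ) + 1)⁻¹) ^ 2) ∧
    ∀ x, ‖x‖ ≤ n + 1 → χ n x = 1 := by
  let f : ContDiffBump (0 : Latent D) := ⟨1, 2, one_pos, one_lt_two⟩
  have hf : ContDiff ℝ ∞ f := f.contDiff
  have hfc : HasCompactSupport f := f.hasCompactSupport
  obtain ⟨C, hC⟩ := (continuous_coordLaplacian hf).bounded_above_of_compact_support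
    (hasCompactSupport_coordLaplacian hfc)
  refine ⟨C, fun n x => f (((n : ℝ) + 1)⁻¹ • x), fun n => ?_⟩
  have hn : (0 : ℝ) < n + 1 := by positivity
  refine ⟨hf.comp (contDiff_const_smul _), ?_, fun x => ⟨f.nonneg, f.le_one⟩, fun x => ?_,
    fun x hx => ?_⟩
  · exact hfc.comp_homeomorph (Homeomorph.smulOfNeZero ((n : ℝ) + 1)⁻¹ (inv_ne_zero hn.ne'))
  · have e : coordLaplacian (fun x => f (((n : ℝ) + 1)⁻¹ • x)) x =
        coordLaplacian f (((n : ℝ) + 1)⁻¹ • x) * (((n : ℝ) + 1)⁻¹) ^ 2 := by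
      unfold coordLaplacian
      rw [Finset.sum_mul]
      refine Finset.sum_congr rfl fun i _ => ?_
      have e1 : (fun y => fderiv ℝ (fun x : Latent D => f (((n : ℝ) + 1)⁻¹ • x)) y
          (EuclideanSpace.single i 1)) = fun y => ((n : ℝ) + 1)⁻¹ •
          (fun y => fderiv ℝ f y (EuclideanSpace.single i 1)) (((n : ℝ) + 1)⁻¹ • y) := by
        ext y
        rw [fderiv_comp_smul]
        rfl
      have hd := (contDiff_fderiv_apply hf (EuclideanSpace.single i 1)).differentiable (by simp)
      have hd' : Differentiable ℝ (fun y : Latent D => (fun y => fderiv ℝ f y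
          (EuclideanSpace.single i 1)) (((n : ℝ) + 1)⁻¹ • y)) := hd.comp (by fun_prop)
      rw [e1, fderiv_fun_const_smul hd'.differentiableAt,
        fderiv_comp_smul (f := fun y => fderiv ℝ f y (EuclideanSpace.single i 1))]
      simp only [smul_apply, smul_eq_mul]
      ring
    rw [e, abs_mul, abs_of_nonneg (a := (((n : ℝ) + 1)⁻¹) ^ 2) (by positivity)]
    gcongr
    exact hC _
  · apply f.one_of_mem_closedBall
    rw [mem_closedBall_zero_iff, norm_smul, norm_inv, Real.norm_of_nonneg hn.le]
    change _ ≤ (1 : ℝ)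
    rw [inv_mul_le_iff₀ hn]
    simpa using hx

end

/-! ### Entropy dissipation and the skewed divergence -/

section

variable {D : ℕ}

section Dissipation

variable {H H' K K' : ℝ → Latent D → ℝ} {H₁ H₂ H₁' H₂' : ℝ → Fin D → Latent D → ℝ}

lemma Dissipation.add (h : Dissipation H H₁ H₂ K) (h' : Dissipation H' H₁' H₂' K') :
    Dissipation (fun t x => H t x + H' t x) (fun t i x => H₁ t i x + H₁' t i x)
      (fun t i x => H₂ t i x + H₂' t i x) (fun t x => K t x + K' t x) where
  cont := h.cont.add h'.cont
  cont₁ i := (h.cont₁ i).add (h'.cont₁ i)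
  cont₂ i := (h.cont₂ i).add (h'.cont₂ i)
  contK := h.contK.add h'.contK
  hasLineDerivAt ht i x := HasDerivAt.add (h.hasLineDerivAt ht i x) (h'.hasLineDerivAt ht i x)
  hasLineDerivAt₁ ht i x := HasDerivAt.add (h.hasLineDerivAt₁ ht i x) (h'.hasLineDerivAt₁ ht i x)
  hasDerivAt ht x := by
    refine ((h.hasDerivAt ht x).add (h'.hasDerivAt ht x)).congr_deriv ?_
    rw [Finset.sum_add_distrib]
    ring

lemma Dissipation.const_mul (h : Dissipation H H₁ H₂ K) (c : ℝ) :
    Dissipation (fun t x => c * H t x) (fun t i x => c * H₁ t i x)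
      (fun t i x => c * H₂ t i x) (fun t x => c * K t x) where
  cont := continuousOn_const.mul h.cont
  cont₁ i := continuousOn_const.mul (h.cont₁ i)
  cont₂ i := continuousOn_const.mul (h.cont₂ i)
  contK := continuousOn_const.mul h.contK
  hasLineDerivAt ht i x := HasDerivAt.const_mul c (h.hasLineDerivAt ht i x)
  hasLineDerivAt₁ ht i x := HasDerivAt.const_mul c (h.hasLineDerivAt₁ ht i x)
  hasDerivAt ht x := by
    refine ((h.hasDerivAt ht x).const_mul c).congr_deriv ?_
    rw [← Finset.mul_sum]
    ring

/-- For `η(r) = r log r`, the chain rule gives `Δ η(u) = η'(u) Δu + η''(u)|∇u|²` with `η''(u) =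
1/u`, so composing a heat solution with `η` leaves exactly the term `|∇u|²/u`. -/
lemma Dissipation.entropy {u : ℝ → Latent D → ℝ} {u₁ u₂ : ℝ → Fin D → Latent D → ℝ}
    (h : Dissipation u u₁ u₂ (fun _ _ => 0)) (hu : ∀ t, 0 < t → ∀ x, 0 < u t x) :
    Dissipation (fun t x => u t x * Real.log (u t x))
      (fun t i x => (Real.log (u t x) + 1) * u₁ t i x)
      (fun t i x => u₁ t i x ^ 2 / u t x + (Real.log (u t x) + 1) * u₂ t i x)
      (fun t x => ∑ i, u₁ t i x ^ 2 / u t x) := by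
  have h0 : ∀ q ∈ (Ioi 0 ×ˢ univ : Set (ℝ × Latent D)), u q.1 q.2 ≠ 0 := by
    rintro ⟨t, x⟩ hq
    exact (hu t (by simpa using hq) x).ne'
  have hlog := h.cont.log h0
  have hsq : ∀ i, ContinuousOn (fun q : ℝ × Latent D => u₁ q.1 i q.2 ^ 2 / u q.1 q.2)
      (Ioi 0 ×ˢ univ) := fun i => ((h.cont₁ i).pow 2).div h.cont h0
  have hη : ∀ r : ℝ, 0 < r → HasDerivAt (fun r => r * Real.log r) (Real.log r + 1) r :=
    fun r hr => Real.hasDerivAt_mul_log hr.ne'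
  refine ⟨h.cont.mul hlog, fun i => (hlog.add continuousOn_const).mul (h.cont₁ i),
    fun i => (hsq i).add ((hlog.add continuousOn_const).mul (h.cont₂ i)),
    continuousOn_finsetSum _ fun i _ => hsq i, fun {t} ht i x => ?_, fun {t} ht i x => ?_,
    fun {t} ht x => ?_⟩
  · have h1 : HasDerivAt _ _ _ := h.hasLineDerivAt ht i x
    exact HasDerivAt.comp (h₂ := fun r => r * Real.log r)
      (h := fun r : ℝ => u t (x + r • EuclideanSpace.single i 1)) (0 : ℝ)
      (by simpa using hη _ (hu t ht x)) h1
  · have h1 : HasDerivAt _ _ _ := h.hasLineDerivAt ht i x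
    have h2 : HasDerivAt _ _ _ := h.hasLineDerivAt₁ ht i x
    have h3 := (h1.log (hu t ht _).ne').add_const 1
    refine HasDerivAt.congr_deriv (h3.mul h2) ?_
    simp only [zero_smul, add_zero]
    ring
  · refine ((hη _ (hu t ht x)).comp t (h.hasDerivAt ht x)).congr_deriv ?_
    rw [Finset.sum_add_distrib, ← Finset.mul_sum]
    ring

end Dissipation

lemma dissipation_heatFlow (μ : Measure (Latent D)) [IsFiniteMeasure μ] :
    Dissipation (heatFlow μ) (heatGrad μ) (heatHess μ) (fun _ _ => 0) where
  cont := continuousOn_heatFlow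
  cont₁ := continuousOn_heatGrad
  cont₂ := continuousOn_heatHess
  contK := continuousOn_const
  hasLineDerivAt := hasLineDerivAt_heatFlow
  hasLineDerivAt₁ := hasLineDerivAt_heatGrad
  hasDerivAt ht x := by simpa using hasDerivAt_heatFlow ht x

/-- The perspective of a convex function of linear growth; up to the factor `1 + M` it is the
integrand of a skewed Jensen-Shannon divergence, and it increases to that of the Kullback-Leibler
divergence as `M → ∞`. -/
noncomputable def skewDiv (M p q : ℝ) : ℝ :=
  p * Real.log p + M * (q * Real.log q) + (-1) * ((p + M * q) * Real.log (p + M * q))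
    + Real.log (1 + M) * (p + M * q)

lemma klFun_le_sq {y : ℝ} (hy : 0 < y) : klFun y ≤ (y - 1) ^ 2 := by
  rw [klFun_apply]
  have := Real.log_le_sub_one_of_pos hy
  nlinarith

/-- The defect of `skewDiv` from the Kullback-Leibler integrand. -/
lemma mul_klFun_sub_skewDiv {M p q : ℝ} (hM : 0 < M) (hp : 0 < p) (hq : 0 < q) :
    q * klFun (p / q) - skewDiv M p q = (1 + M) * q * klFun ((p + M * q) / ((1 + M) * q)) := by
  rw [klFun_apply, klFun_apply, skewDiv, Real.log_div hp.ne' hq.ne',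
    Real.log_div (by positivity) (by positivity), Real.log_mul (by positivity) hq.ne']
  field_simp
  ring

lemma skewDiv_le {M p q : ℝ} (hM : 0 < M) (hp : 0 < p) (hq : 0 < q) :
    skewDiv M p q ≤ q * klFun (p / q) := by
  have h1 := mul_klFun_sub_skewDiv hM hp hq
  have h2 : 0 ≤ klFun ((p + M * q) / ((1 + M) * q)) := klFun_nonneg (by positivity)
  have h3 : 0 ≤ (1 + M) * q * klFun ((p + M * q) / ((1 + M) * q)) := by positivity
  linarith

/-- By `klFun y ≤ (y - 1)²` the defect is at most `(p - q)² / (q (1 + M))`. -/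
lemma tendsto_skewDiv {p q : ℝ} (hp : 0 < p) (hq : 0 < q) :
    Tendsto (fun n : ℕ => skewDiv (n + 1) p q) atTop (𝓝 (q * klFun (p / q))) := by
  have h1 : ∀ n : ℕ, q * klFun (p / q) - (p - q) ^ 2 / q * (1 / ((n : ℝ) + 1))
      ≤ skewDiv (n + 1) p q := by
    intro n
    have hn : (0 : ℝ) < n + 1 := by positivity
    have h2 := mul_klFun_sub_skewDiv hn hp hq
    have h3 := klFun_le_sq (y := (p + (n + 1) * q) / ((1 + (n + 1)) * q)) (by positivity)
    have h4 : (1 + ((n : ℝ) + 1)) * q * ((p + (n + 1) * q) / ((1 + (n + 1)) * q) - 1) ^ 2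
        = (p - q) ^ 2 / q * (1 / (1 + ((n : ℝ) + 1))) := by
      field_simp
      ring
    have h5 : (p - q) ^ 2 / q * (1 / (1 + ((n : ℝ) + 1))) ≤ (p - q) ^ 2 / q * (1 / ((n : ℝ) + 1)) :=
      mul_le_mul_of_nonneg_left (one_div_le_one_div_of_le hn (by linarith)) (by positivity)
    have h6 := mul_le_mul_of_nonneg_left h3 (a := (1 + ((n : ℝ) + 1)) * q) (by positivity)
    linarith
  have h2 : Tendsto (fun n : ℕ => q * klFun (p / q) - (p - q) ^ 2 / q * (1 / ((n : ℝ) + 1))) atTop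
      (𝓝 (q * klFun (p / q))) := by
    have := (tendsto_one_div_add_atTop_nhds_zero_nat (𝕜 := ℝ)).const_mul ((p - q) ^ 2 / q)
    simpa using (tendsto_const_nhds (x := q * klFun (p / q))).sub this
  exact tendsto_of_tendsto_of_tendsto_of_le_of_le h2 tendsto_const_nhds h1
    fun n => skewDiv_le (by positivity) hp hq

lemma skewDiv_eq {M p q : ℝ} (hM : 0 < M) (hp : 0 < p) (hq : 0 < q) :
    skewDiv M p q = p * Real.log (p / ((p + M * q) / (1 + M)))
      + M * (q * Real.log (q / ((p + M * q) / (1 + M)))) := by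
  rw [skewDiv, Real.log_div hp.ne' (by positivity), Real.log_div hq.ne' (by positivity),
    Real.log_div (by positivity) (by positivity)]
  ring

/-- With `m = (p + Mq)/(1 + M)`, applying `log x ≥ 1 - 1/x` to both terms leaves `p + Mq - (1 + M)m
= 0`. -/
lemma skewDiv_nonneg {M p q : ℝ} (hM : 0 < M) (hp : 0 < p) (hq : 0 < q) : 0 ≤ skewDiv M p q := by
  rw [skewDiv_eq hM hp hq]
  set m := (p + M * q) / (1 + M) with hm
  have hm0 : 0 < m := by positivity
  have h1 := Real.one_sub_inv_le_log_of_pos (x := p / m) (by positivity)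
  have h2 := Real.one_sub_inv_le_log_of_pos (x := q / m) (by positivity)
  have h3 := mul_le_mul_of_nonneg_left h1 hp.le
  have h4 := mul_le_mul_of_nonneg_left h2 (mul_pos hM hq).le
  have h5 : p * (1 - (p / m)⁻¹) + M * q * (1 - (q / m)⁻¹) = 0 := by
    rw [hm]
    field_simp
    ring
  linarith

/-- The mixture `m` dominates `p/(1 + M)` and `Mq/(1 + M)`, so in `log x ≤ x - 1` the ratios stay
below `1 + M`. This linear bound is what the Kullback-Leibler integrand lacks; it gives both
integrability and decay at large times. -/
lemma skewDiv_le_abs {M p q : ℝ} (hM : 0 < M) (hp : 0 < p) (hq : 0 < q) :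
    skewDiv M p q ≤ (1 + M) * |p - q| := by
  rw [skewDiv_eq hM hp hq]
  set m := (p + M * q) / (1 + M) with hm
  have hm0 : 0 < m := by positivity
  have hpm : p / m ≤ 1 + M := by
    rw [hm, div_le_iff₀ (by positivity)]
    have := mul_pos hM hq
    field_simp
    linarith
  have hqm : M * (q / m) ≤ 1 + M := by
    rw [hm, ← mul_div_assoc, div_le_iff₀ (by positivity)]
    field_simp
    linarith
  have h1 := mul_le_mul_of_nonneg_left
    (Real.log_le_sub_one_of_pos (x := p / m) (by positivity)) hp.le
  have h2 := mul_le_mul_of_nonneg_left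
    (Real.log_le_sub_one_of_pos (x := q / m) (by positivity)) (mul_pos hM hq).le
  have h3 : p * (p / m - 1) = p / m * (M / (1 + M) * (p - q)) := by
    have : p - m = M / (1 + M) * (p - q) := by rw [hm]; field_simp; ring
    rw [← this]; field_simp
  have h4 : M * q * (q / m - 1) = M * (q / m) * (1 / (1 + M) * (q - p)) := by
    have : q - m = 1 / (1 + M) * (q - p) := by rw [hm]; field_simp; ring
    rw [← this]; field_simp
  have h5 : p / m * (M / (1 + M) * (p - q)) ≤ (1 + M) * (M / (1 + M) * |p - q|) := by
    have h8 : M / (1 + M) * (p - q) ≤ M / (1 + M) * |p - q| :=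
      mul_le_mul_of_nonneg_left (le_abs_self _) (by positivity)
    exact (mul_le_mul_of_nonneg_left h8 (by positivity)).trans
      (mul_le_mul_of_nonneg_right hpm (by positivity))
  have h6 : M * (q / m) * (1 / (1 + M) * (q - p)) ≤ (1 + M) * (1 / (1 + M) * |p - q|) := by
    have h8 : 1 / (1 + M) * (q - p) ≤ 1 / (1 + M) * |p - q| :=
      mul_le_mul_of_nonneg_left (by rw [abs_sub_comm]; exact le_abs_self _) (by positivity)
    exact (mul_le_mul_of_nonneg_left h8 (by positivity)).trans
      (mul_le_mul_of_nonneg_right hqm (by positivity))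
  have h7 : (1 + M) * (M / (1 + M) * |p - q|) + (1 + M) * (1 / (1 + M) * |p - q|)
      = (1 + M) * |p - q| := by field_simp; ring
  linarith

/-- The integrand of the relative Fisher information of `μ * N(0, t I)` from `ν * N(0, t I)`. -/
noncomputable def fisherDensity (μ ν : Measure (Latent D)) (t : ℝ) (x : Latent D) : ℝ :=
  heatFlow μ t x *
    ∑ i, (heatGrad μ t i x / heatFlow μ t x - heatGrad ν t i x / heatFlow ν t x) ^ 2

/-- The dissipation rate of `skewDiv` along the heat flow. -/
noncomputable def skewFisher (M : ℝ) (μ ν : Measure (Latent D)) (t : ℝ) (x : Latent D) : ℝ :=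
  M * heatFlow ν t x / (heatFlow μ t x + M * heatFlow ν t x) * fisherDensity μ ν t x

variable {μ ν : Measure (Latent D)} [IsProbabilityMeasure μ] [IsProbabilityMeasure ν]

omit [IsProbabilityMeasure ν] in
lemma fisherDensity_nonneg {t : ℝ} (ht : 0 < t) (x : Latent D) : 0 ≤ fisherDensity μ ν t x :=
  mul_nonneg (heatFlow_pos ht x).le (Finset.sum_nonneg fun _ _ => sq_nonneg _)

lemma skewFisher_nonneg {M : ℝ} (hM : 0 < M) {t : ℝ} (ht : 0 < t) (x : Latent D) :
    0 ≤ skewFisher M μ ν t x := by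
  have h1 := heatFlow_pos (μ := μ) ht x
  have h2 := heatFlow_pos (μ := ν) ht x
  have h3 := fisherDensity_nonneg (μ := μ) (ν := ν) ht x
  unfold skewFisher
  positivity

lemma skewFisher_le {M : ℝ} (hM : 0 < M) {t : ℝ} (ht : 0 < t) (x : Latent D) :
    skewFisher M μ ν t x ≤ fisherDensity μ ν t x := by
  have h1 := heatFlow_pos (μ := μ) ht x
  have h2 := heatFlow_pos (μ := ν) ht x
  refine mul_le_of_le_one_left (fisherDensity_nonneg ht x) ?_
  rw [div_le_one (by positivity)]
  linarith

lemma tendsto_skewFisher {t : ℝ} (ht : 0 < t) (x : Latent D) :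
    Tendsto (fun n : ℕ => skewFisher (n + 1) μ ν t x) atTop (𝓝 (fisherDensity μ ν t x)) := by
  have h1 := heatFlow_pos (μ := μ) ht x
  have h2 := heatFlow_pos (μ := ν) ht x
  have h3 : Tendsto (fun n : ℕ => ((n : ℝ) + 1) * heatFlow ν t x /
      (heatFlow μ t x + ((n : ℝ) + 1) * heatFlow ν t x)) atTop (𝓝 1) := by
    have h4 : ∀ n : ℕ, ((n : ℝ) + 1) * heatFlow ν t x /
        (heatFlow μ t x + ((n : ℝ) + 1) * heatFlow ν t x) =
        heatFlow ν t x / (heatFlow μ t x * (1 / ((n : ℝ) + 1)) + heatFlow ν t x) := by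
      intro n
      field_simp
    simp_rw [h4]
    have h5 := (((tendsto_one_div_add_atTop_nhds_zero_nat (𝕜 := ℝ)).const_mul
      (heatFlow μ t x)).add_const (heatFlow ν t x))
    rw [mul_zero, zero_add] at h5
    have h6 := (tendsto_const_nhds (x := heatFlow ν t x)).div h5 h2.ne'
    rwa [div_self h2.ne'] at h6
  simpa [skewFisher] using h3.mul_const (fisherDensity μ ν t x)

/-- `skewDiv` is a linear combination of entropies of the heat solutions `u`, `v`, `u + Mv` and a
linear term. The rate follows from `|∇u|²/u + M|∇v|²/v - |∇(u + Mv)|²/(u + Mv) = (M u v/(u + Mv))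
|∇u/u - ∇v/v|²`. -/
lemma dissipation_skewDiv (μ ν : Measure (Latent D)) [IsProbabilityMeasure μ]
    [IsProbabilityMeasure ν] {M : ℝ} (hM : 0 < M) : ∃ H₁ H₂ K : _,
    Dissipation (fun t x => skewDiv M (heatFlow μ t x) (heatFlow ν t x)) H₁ H₂ K ∧
      ∀ t, 0 < t → ∀ x, K t x = skewFisher M μ ν t x := by
  have hμ := dissipation_heatFlow μ
  have hν := dissipation_heatFlow ν
  have hm := hμ.add (hν.const_mul M)
  simp only [mul_zero, add_zero] at hm
  have hpos : ∀ t, 0 < t → ∀ x, 0 < heatFlow μ t x + M * heatFlow ν t x := fun t ht x =>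
    add_pos (heatFlow_pos ht x) (mul_pos hM (heatFlow_pos ht x))
  have key := (((hμ.entropy fun t ht x => heatFlow_pos ht x).add
    ((hν.entropy fun t ht x => heatFlow_pos ht x).const_mul M)).add
    ((hm.entropy hpos).const_mul (-1))).add (hm.const_mul (Real.log (1 + M)))
  refine ⟨_, _, _, key, fun t ht x => ?_⟩
  have h1 := heatFlow_pos (μ := μ) ht x
  have h2 := heatFlow_pos (μ := ν) ht x
  have h3 := hpos t ht x
  simp only [skewFisher, fisherDensity, mul_zero, add_zero, Finset.mul_sum]
  rw [← Finset.sum_add_distrib, ← Finset.sum_add_distrib]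
  refine Finset.sum_congr rfl fun i _ => ?_
  field_simp
  ring

end

/-! ### Measurability in parameters and merging of heat flows in total variation -/

section

variable {D : ℕ}

/-- Fatou gives the lower bound and `f n ≤ F` the upper one; neither monotonicity in `n` nor a
finite integral of `F` is needed. -/
lemma tendsto_lintegral_of_le_of_tendsto {α : Type*} [MeasurableSpace α] {μ : Measure α}
    {f : ℕ → α → ℝ≥0∞} {F : α → ℝ≥0∞} (hf : ∀ n, AEMeasurable (f n) μ)
    (hle : ∀ n, ∀ᵐ x ∂μ, f n x ≤ F x)
    (hlim : ∀ᵐ x ∂μ, Tendsto (fun n => f n x) atTop (𝓝 (F x))) :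
    Tendsto (fun n => ∫⁻ x, f n x ∂μ) atTop (𝓝 (∫⁻ x, F x ∂μ)) := by
  refine tendsto_of_le_liminf_of_limsup_le ?_ ?_
  · calc ∫⁻ x, F x ∂μ = ∫⁻ x, liminf (fun n => f n x) atTop ∂μ :=
          lintegral_congr_ae (hlim.mono fun x h => h.liminf_eq.symm)
      _ ≤ _ := lintegral_liminf_le' hf
  · exact limsup_le_of_le (h := Eventually.of_forall fun n => lintegral_mono_ae (hle n))

lemma measurable_heatMoment_kernel {S : Type*} [MeasurableSpace S] (κ : Kernel S (Latent D))
    [IsSFiniteKernel κ] {w : Latent D → ℝ} (hw : Measurable w) :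
    Measurable (fun r : S × ℝ × Latent D => heatMoment (κ r.1) w r.2.1 r.2.2) := by
  unfold heatMoment
  have h : Measurable (fun r : (S × ℝ × Latent D) × Latent D =>
      w (r.1.2.2 - r.2) * heatKernel r.1.2.1 (r.1.2.2 - r.2)) := by
    fun_prop
  have := h.stronglyMeasurable.integral_kernel_prod_right'
    (κ := κ.comap (Prod.fst : S × ℝ × Latent D → S) measurable_fst)
  exact this.measurable

section Kernel

variable {S : Type*} [MeasurableSpace S] (κ η : Kernel S (Latent D)) [IsSFiniteKernel κ]
  [IsSFiniteKernel η]

lemma measurable_heatFlow_kernel :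
    Measurable (fun r : S × ℝ × Latent D => heatFlow (κ r.1) r.2.1 r.2.2) :=
  measurable_heatMoment_kernel κ measurable_const

lemma measurable_heatGrad_kernel (i : Fin D) :
    Measurable (fun r : S × ℝ × Latent D => heatGrad (κ r.1) r.2.1 i r.2.2) :=
  Measurable.mul (by fun_prop) (measurable_heatMoment_kernel κ (w := fun y => y i) (by fun_prop))

lemma measurable_fisherDensity_kernel :
    Measurable (fun r : S × ℝ × Latent D => fisherDensity (κ r.1) (η r.1) r.2.1 r.2.2) := by
  unfold fisherDensity
  refine (measurable_heatFlow_kernel κ).mul (Finset.measurable_sum _ fun i _ => ?_)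
  exact (((measurable_heatGrad_kernel κ i).div (measurable_heatFlow_kernel κ)).sub
    ((measurable_heatGrad_kernel η i).div (measurable_heatFlow_kernel η))).pow_const 2

end Kernel

lemma measurable_heatFlow (μ : Measure (Latent D)) [SFinite μ] :
    Measurable (fun q : ℝ × Latent D => heatFlow μ q.1 q.2) :=
  (measurable_heatFlow_kernel (Kernel.const Unit μ)).comp (measurable_prodMk_left (x := ()))

lemma measurable_fisherDensity (μ ν : Measure (Latent D)) [SFinite μ] [SFinite ν] :
    Measurable (fun q : ℝ × Latent D => fisherDensity μ ν q.1 q.2) :=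
  (measurable_fisherDensity_kernel (Kernel.const Unit μ) (Kernel.const Unit ν)).comp
    (measurable_prodMk_left (x := ()))

lemma measurable_skewFisher (M : ℝ) (μ ν : Measure (Latent D)) [SFinite μ] [SFinite ν] :
    Measurable (fun q : ℝ × Latent D => skewFisher M μ ν q.1 q.2) := by
  unfold skewFisher
  exact (((measurable_heatFlow ν).const_mul M).div
    ((measurable_heatFlow μ).add ((measurable_heatFlow ν).const_mul M))).mul
    (measurable_fisherDensity μ ν)

lemma measurable_skewDiv (M : ℝ) : Measurable (fun r : ℝ × ℝ => skewDiv M r.1 r.2) := by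
  unfold skewDiv; fun_prop

lemma ofReal_heatFlow (μ : Measure (Latent D)) [IsFiniteMeasure μ] {t : ℝ} (ht : 0 < t)
    (x : Latent D) :
    ENNReal.ofReal (heatFlow μ t x) = ∫⁻ z, ENNReal.ofReal (heatKernel t (x - z)) ∂μ := by
  unfold heatFlow heatMoment
  rw [ofReal_integral_eq_lintegral_ofReal ((QuadWeight.const 1).integrable ht x)
    (ae_of_all _ fun z => by simpa using (heatKernel_pos ht (x - z)).le)]
  simp

lemma lintegral_mul_heatFlow (μ : Measure (Latent D)) [IsFiniteMeasure μ] {t : ℝ} (ht : 0 < t)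
    (F : Latent D → ℝ≥0∞) (hF : Measurable F) :
    ∫⁻ y, F y * ENNReal.ofReal (heatFlow μ t y) =
      ∫⁻ z, ∫⁻ ε, F (z + √t • ε) ∂(stdGaussian (Latent D)) ∂μ := by
  have hm : Measurable (fun q : Latent D × Latent D =>
      F q.1 * ENNReal.ofReal (heatKernel t (q.1 - q.2))) := by fun_prop
  calc ∫⁻ y, F y * ENNReal.ofReal (heatFlow μ t y)
      = ∫⁻ y, (∫⁻ z, F y * ENNReal.ofReal (heatKernel t (y - z)) ∂μ) := by
        refine lintegral_congr fun y => ?_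
        rw [ofReal_heatFlow μ ht]
        exact (lintegral_const_mul (F y) (f := fun z => ENNReal.ofReal (heatKernel t (y - z)))
          (by fun_prop)).symm
    _ = ∫⁻ z, (∫⁻ y, F y * ENNReal.ofReal (heatKernel t (y - z))) ∂μ :=
        lintegral_lintegral_swap hm.aemeasurable
    _ = _ := lintegral_congr fun z => (lintegral_stdGaussian F hF ht z).symm

variable {μ ν : Measure (Latent D)} [IsProbabilityMeasure μ] [IsProbabilityMeasure ν]

lemma lintegral_heatFlow {t : ℝ} (ht : 0 < t) : ∫⁻ y, ENNReal.ofReal (heatFlow μ t y) = 1 := by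
  simpa using lintegral_mul_heatFlow μ ht (fun _ => 1) measurable_const

lemma continuous_heatFlow {t : ℝ} (ht : 0 < t) : Continuous (heatFlow μ t) :=
  continuous_section continuousOn_heatFlow ht

lemma integrable_heatFlow {t : ℝ} (ht : 0 < t) : Integrable (heatFlow μ t) :=
  (lintegral_ofReal_ne_top_iff_integrable (continuous_heatFlow ht).aestronglyMeasurable
    (ae_of_all _ fun x => (heatFlow_pos ht x).le)).1 (by simp [lintegral_heatFlow ht])

lemma integral_heatFlow {t : ℝ} (ht : 0 < t) : ∫ y, heatFlow μ t y = 1 := by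
  rw [integral_eq_lintegral_of_nonneg_ae (ae_of_all _ fun x => (heatFlow_pos ht x).le)
    (continuous_heatFlow ht).aestronglyMeasurable, lintegral_heatFlow ht]
  simp

/-- After rescaling to time one the shift is `z/√(n + 1)`, which tends to zero, and translation of
the Gaussian density is continuous in `L¹`. -/
lemma tendsto_lintegral_heatKernel_shift (z : Latent D) :
    Tendsto (fun n : ℕ => ∫⁻ y, ENNReal.ofReal
      |heatKernel ((n : ℝ) + 1) (y - z) - heatKernel ((n : ℝ) + 1) y|) atTop (𝓝 0) := by
  have h1 : ∀ n : ℕ, ∫⁻ y, ENNReal.ofReal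
      |heatKernel ((n : ℝ) + 1) (y - z) - heatKernel ((n : ℝ) + 1) y| =
      ∫⁻ x : Latent D, ENNReal.ofReal
        |heatKernel 1 (x - (√((n : ℝ) + 1))⁻¹ • z) - heatKernel 1 x| := by
    intro n
    have hn : (0 : ℝ) < n + 1 := by positivity
    have hs : 0 < √((n : ℝ) + 1) := Real.sqrt_pos.2 hn
    rw [lintegral_eq_lintegral_comp_smul _ _ hn]
    · refine lintegral_congr fun x => ?_
      rw [← ENNReal.ofReal_mul (by positivity), ← pow_mul_heatKernel_smul hn x,
        ← pow_mul_heatKernel_smul hn (x - (√((n : ℝ) + 1))⁻¹ • z), smul_sub, smul_smul,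
        mul_inv_cancel₀ hs.ne', one_smul, ← mul_sub, abs_mul, abs_of_pos (pow_pos hs D)]
    · fun_prop
  simp_rw [h1]
  have hlim : Tendsto (fun n : ℕ => (√((n : ℝ) + 1))⁻¹ • z) atTop (𝓝 0) := by
    have h2 : Tendsto (fun n : ℕ => √((n : ℝ) + 1)) atTop atTop :=
      Real.tendsto_sqrt_atTop.comp (tendsto_natCast_atTop_atTop.atTop_add tendsto_const_nhds)
    simpa using h2.inv_tendsto_atTop.smul_const z
  set c : ℝ := (2 * Real.pi * 1) ^ (-(D : ℝ) / 2) with hc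
  set c' : ℝ := (2 * Real.pi * 2) ^ (-(D : ℝ) / 2) with hc'
  have hc0 : 0 < c := by positivity
  have hc0' : 0 < c' := by positivity
  -- From `‖x‖² ≤ 2‖x - h‖² + 2`, a kernel at time one shifted by at most one is dominated by a
  -- multiple of the kernel at time two; `c / c'` corrects the normalizations.
  have hdom : ∀ h : Latent D, ‖h‖ ≤ 1 → ∀ x,
      heatKernel 1 (x - h) ≤ c / c' * Real.exp (1 / 2) * heatKernel 2 x := by
    intro h hh x
    unfold heatKernel
    rw [← hc, ← hc']
    have h3 : ‖x‖ ≤ ‖x - h‖ + ‖h‖ := by simpa using norm_add_le (x - h) h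
    have h4 : ‖x‖ ^ 2 ≤ 2 * ‖x - h‖ ^ 2 + 2 := by
      nlinarith [norm_nonneg x, norm_nonneg h, norm_nonneg (x - h), sq_nonneg (‖x - h‖ - ‖h‖)]
    have h5 : Real.exp (-‖x - h‖ ^ 2 / (2 * 1)) ≤
        Real.exp (1 / 2) * Real.exp (-‖x‖ ^ 2 / (2 * 2)) := by
      rw [← Real.exp_add, Real.exp_le_exp]
      linarith
    calc c * Real.exp (-‖x - h‖ ^ 2 / (2 * 1))
        ≤ c * (Real.exp (1 / 2) * Real.exp (-‖x‖ ^ 2 / (2 * 2))) := by gcongr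
      _ = _ := by field_simp
  have hz : ∫⁻ x : Latent D, (0 : ℝ≥0∞) = 0 := by simp
  rw [← hz]
  refine tendsto_lintegral_filter_of_dominated_convergence
    (fun x => ENNReal.ofReal (c / c' * Real.exp (1 / 2) * heatKernel 2 x + heatKernel 1 x))
    ?_ ?_ ?_ ?_
  · exact Eventually.of_forall fun n => by fun_prop
  · have h6 : ∀ᶠ n : ℕ in atTop, ‖(√((n : ℝ) + 1))⁻¹ • z‖ ≤ 1 := by
      have := hlim.norm
      rw [norm_zero] at this
      exact this.eventually_le_const one_pos
    filter_upwards [h6] with n hn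
    refine ae_of_all _ fun x => ENNReal.ofReal_le_ofReal ?_
    refine (abs_sub _ _).trans ?_
    rw [abs_of_pos (heatKernel_pos one_pos _), abs_of_pos (heatKernel_pos one_pos _)]
    exact add_le_add_left (hdom _ hn x) _
  · exact (((integrable_heatKernel two_pos).const_mul _).add
      (integrable_heatKernel one_pos)).lintegral_lt_top.ne
  · refine ae_of_all _ fun x => ?_
    have h7 : Tendsto (fun n : ℕ => heatKernel 1 (x - (√((n : ℝ) + 1))⁻¹ • z)) atTop
        (𝓝 (heatKernel 1 x)) := by
      have h8 := (continuous_heatKernel (t := 1)).tendsto x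
      refine h8.comp ?_
      simpa using (tendsto_const_nhds (x := x)).sub hlim
    have h9 := ENNReal.tendsto_ofReal (h7.sub_const (heatKernel 1 x)).abs
    simpa using h9

/-- Under the heat flow every law approaches the Gaussian in total variation. -/
lemma tendsto_lintegral_heatFlow_sub_heatKernel (μ : Measure (Latent D)) [IsProbabilityMeasure μ] :
    Tendsto (fun n : ℕ => ∫⁻ y, ENNReal.ofReal
      |heatFlow μ ((n : ℝ) + 1) y - heatKernel ((n : ℝ) + 1) y|) atTop (𝓝 0) := by
  have hz : ∫⁻ x : Latent D, (0 : ℝ≥0∞) ∂μ = 0 := by simp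
  have hm : ∀ t : ℝ, Measurable (fun q : Latent D × Latent D =>
      ENNReal.ofReal |heatKernel t (q.2 - q.1) - heatKernel t q.2|) := fun t => by fun_prop
  -- The triangle inequality for integrals and Tonelli reduce the claim to single shifts by `z`;
  -- total mass two dominates.
  have hmain : Tendsto (fun n : ℕ => ∫⁻ z, (∫⁻ y, ENNReal.ofReal
      |heatKernel ((n : ℝ) + 1) (y - z) - heatKernel ((n : ℝ) + 1) y|) ∂μ) atTop (𝓝 0) := by
    rw [← hz]
    refine tendsto_lintegral_of_dominated_convergence (μ := μ) (fun _ => 2) ?_ ?_ (by simp) ?_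
    · exact fun n => (hm _).lintegral_prod_right'
    · refine fun n => ae_of_all _ fun z => ?_
      have hn : (0 : ℝ) < n + 1 := by positivity
      calc ∫⁻ y, ENNReal.ofReal |heatKernel ((n : ℝ) + 1) (y - z) - heatKernel ((n : ℝ) + 1) y|
          ≤ ∫⁻ y, (ENNReal.ofReal (heatKernel ((n : ℝ) + 1) (y - z))
            + ENNReal.ofReal (heatKernel ((n : ℝ) + 1) (y - 0))) := by
            refine lintegral_mono fun y => ?_
            rw [← ENNReal.ofReal_add (heatKernel_pos hn _).le (heatKernel_pos hn _).le]
            refine ENNReal.ofReal_le_ofReal ((abs_sub _ _).trans ?_)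
            rw [abs_of_pos (heatKernel_pos hn _), abs_of_pos (heatKernel_pos hn _), sub_zero]
        _ = 2 := by
            rw [lintegral_add_left, lintegral_heatKernel hn, lintegral_heatKernel hn, one_add_one_eq_two]
            fun_prop
    · exact ae_of_all _ fun z => tendsto_lintegral_heatKernel_shift z
  refine tendsto_of_tendsto_of_tendsto_of_le_of_le tendsto_const_nhds hmain (fun n => zero_le)
    fun n => ?_
  have hn : (0 : ℝ) < n + 1 := by positivity
  dsimp only
  rw [lintegral_lintegral_swap (hm _).aemeasurable]
  refine lintegral_mono fun y => ?_
  have h1 : heatFlow μ ((n : ℝ) + 1) y - heatKernel ((n : ℝ) + 1) y =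
      ∫ z, (heatKernel ((n : ℝ) + 1) (y - z) - heatKernel ((n : ℝ) + 1) y) ∂μ := by
    have hi := (QuadWeight.const (D := D) 1).integrable (μ := μ) hn y
    simp only [one_mul] at hi
    rw [integral_sub hi (integrable_const _)]
    simp [heatFlow, heatMoment]
  rw [h1, ← Real.norm_eq_abs, ofReal_norm]
  refine (enorm_integral_le_lintegral_enorm _).trans (le_of_eq (lintegral_congr fun z => ?_))
  rw [← ofReal_norm, Real.norm_eq_abs]

lemma tendsto_lintegral_abs_heatFlow_sub (μ ν : Measure (Latent D)) [IsProbabilityMeasure μ]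
    [IsProbabilityMeasure ν] :
    Tendsto (fun n : ℕ => ∫⁻ y, ENNReal.ofReal
      |heatFlow μ ((n : ℝ) + 1) y - heatFlow ν ((n : ℝ) + 1) y|) atTop (𝓝 0) := by
  have h := (tendsto_lintegral_heatFlow_sub_heatKernel μ).add
    (tendsto_lintegral_heatFlow_sub_heatKernel ν)
  rw [add_zero] at h
  refine tendsto_of_tendsto_of_tendsto_of_le_of_le tendsto_const_nhds h (fun n => zero_le)
    fun n => ?_
  have hn : (0 : ℝ) < n + 1 := by positivity
  dsimp only
  rw [← lintegral_add_left]
  · refine lintegral_mono fun y => ?_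
    rw [← ENNReal.ofReal_add (abs_nonneg _) (abs_nonneg _)]
    refine ENNReal.ofReal_le_ofReal ?_
    rw [abs_sub_comm (heatFlow ν _ _)]
    exact abs_sub_le _ _ _
  · exact ((continuous_heatFlow hn).measurable.sub
      continuous_heatKernel.measurable).abs.ennreal_ofReal

end

/-! ### De Bruijn's identity from a positive time to infinity -/

section

variable {D : ℕ} {μ ν : Measure (Latent D)} [IsProbabilityMeasure μ] [IsProbabilityMeasure ν]

lemma skewDiv_heatFlow_nonneg {M : ℝ} (hM : 0 < M) {t : ℝ} (ht : 0 < t) (x : Latent D) :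
    0 ≤ skewDiv M (heatFlow μ t x) (heatFlow ν t x) :=
  skewDiv_nonneg hM (heatFlow_pos ht x) (heatFlow_pos ht x)

lemma measurable_skewDiv_heatFlow (M : ℝ) {t : ℝ} (ht : 0 < t) :
    Measurable (fun x => skewDiv M (heatFlow μ t x) (heatFlow ν t x)) :=
  (measurable_skewDiv M).comp
    ((continuous_heatFlow ht).measurable.prodMk (continuous_heatFlow ht).measurable)

lemma skewDiv_heatFlow_le {M : ℝ} (hM : 0 < M) {t : ℝ} (ht : 0 < t) (x : Latent D) :
    skewDiv M (heatFlow μ t x) (heatFlow ν t x) ≤ (1 + M) * (heatFlow μ t x + heatFlow ν t x) := by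
  have h1 := heatFlow_pos (μ := μ) ht x
  have h2 := heatFlow_pos (μ := ν) ht x
  refine (skewDiv_le_abs hM h1 h2).trans (mul_le_mul_of_nonneg_left ?_ (by positivity))
  refine (abs_sub _ _).trans ?_
  rw [abs_of_pos h1, abs_of_pos h2]

lemma integrable_skewDiv_heatFlow {M : ℝ} (hM : 0 < M) {t : ℝ} (ht : 0 < t) :
    Integrable (fun x => skewDiv M (heatFlow μ t x) (heatFlow ν t x)) :=
  ((((integrable_heatFlow ht).add (integrable_heatFlow ht)).const_mul (1 + M))).mono'
    (measurable_skewDiv_heatFlow M ht).aestronglyMeasurable (ae_of_all _ fun x => by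
      rw [Real.norm_of_nonneg (skewDiv_heatFlow_nonneg hM ht x)]
      exact skewDiv_heatFlow_le hM ht x)

lemma integral_skewDiv_heatFlow_le {M : ℝ} (hM : 0 < M) {t : ℝ} (ht : 0 < t) :
    ∫ x, skewDiv M (heatFlow μ t x) (heatFlow ν t x) ≤ (1 + M) * 2 := by
  calc ∫ x, skewDiv M (heatFlow μ t x) (heatFlow ν t x)
      ≤ ∫ x, (1 + M) * (heatFlow μ t x + heatFlow ν t x) :=
        integral_mono (integrable_skewDiv_heatFlow hM ht)
          (((integrable_heatFlow ht).add (integrable_heatFlow ht)).const_mul (1 + M))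
          (skewDiv_heatFlow_le hM ht)
    _ = _ := by
        rw [integral_const_mul, integral_add (integrable_heatFlow ht) (integrable_heatFlow ht),
          integral_heatFlow ht, integral_heatFlow ht]
        norm_num

/-- Removal of the cutoff. All terms are nonnegative, so they converge to the full integrals, except
the term with the Laplacian of the cutoff, which vanishes. -/
lemma lintegral_skewDiv_eq_add {M : ℝ} (hM : 0 < M) {a b : ℝ} (ha : 0 < a) (hab : a ≤ b) :
    ∫⁻ x, ENNReal.ofReal (skewDiv M (heatFlow μ a x) (heatFlow ν a x)) =
      (∫⁻ x, ENNReal.ofReal (skewDiv M (heatFlow μ b x) (heatFlow ν b x))) +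
      ENNReal.ofReal (1 / 2) * ∫⁻ q, ENNReal.ofReal (skewFisher M μ ν q.1 q.2)
        ∂((volume.restrict (Ioc a b)).prod volume) := by
  have hb : 0 < b := ha.trans_le hab
  obtain ⟨H₁, H₂, K, hd, hK⟩ := dissipation_skewDiv μ ν hM
  obtain ⟨C, χ, hχ⟩ := exists_cutoff D
  set h : ℝ → Latent D → ℝ := fun t x => skewDiv M (heatFlow μ t x) (heatFlow ν t x) with hh
  have hχlim : ∀ x, Tendsto (fun n => χ n x) atTop (𝓝 1) := by
    intro x
    refine tendsto_const_nhds.congr' ?_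
    obtain ⟨N, hN⟩ := exists_nat_ge ‖x‖
    filter_upwards [eventually_ge_atTop N] with n hn
    refine ((hχ n).2.2.2.2 x ?_).symm
    have : (N : ℝ) ≤ n := by exact_mod_cast hn
    linarith
  have hKpos : ∀ t, 0 < t → ∀ x, 0 ≤ K t x := fun t ht x => by
    rw [hK t ht x]; exact skewFisher_nonneg hM ht x
  have hint : ∀ n t, 0 < t → Integrable (fun x => χ n x * h t x) := fun n t ht =>
    (((hχ n).1.continuous.mul (continuous_section hd.cont ht)).integrable_of_hasCompactSupport
      (hχ n).2.1.mul_right)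
  have hT : ∀ t, 0 < t → Tendsto (fun n => ENNReal.ofReal (∫ x, χ n x * h t x)) atTop
      (𝓝 (∫⁻ x, ENNReal.ofReal (h t x))) := by
    intro t ht
    have e : ∀ n, ENNReal.ofReal (∫ x, χ n x * h t x) = ∫⁻ x, ENNReal.ofReal (χ n x * h t x) :=
      fun n => ofReal_integral_eq_lintegral_ofReal (hint n t ht) (ae_of_all _ fun x =>
        mul_nonneg ((hχ n).2.2.1 x).1 (skewDiv_heatFlow_nonneg hM ht x))
    simp_rw [e]
    refine tendsto_lintegral_of_le_of_tendsto
      (fun n => (hint n t ht).aestronglyMeasurable.aemeasurable.ennreal_ofReal)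
      (fun n => ae_of_all _ fun x => ENNReal.ofReal_le_ofReal ?_)
      (ae_of_all _ fun x => ENNReal.tendsto_ofReal ?_)
    · exact mul_le_of_le_one_left (skewDiv_heatFlow_nonneg hM ht x) ((hχ n).2.2.1 x).2
    · simpa using (hχlim x).mul_const (h t x)
  set m : Measure (ℝ × Latent D) := (volume.restrict (Ioc a b)).prod volume with hm
  have hmem : ∀ᵐ q ∂m, q.1 ∈ Ioc a b := by
    have h0 : ∀ᵐ t ∂(volume.restrict (Ioc a b)), t ∈ Ioc a b := ae_restrict_mem measurableSet_Ioc
    exact Measure.quasiMeasurePreserving_fst.ae h0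
  have hpos : ∀ᵐ q ∂m, 0 < q.1 := hmem.mono fun q hq => ha.trans hq.1
  have hKint : ∀ n, Integrable (fun q : ℝ × Latent D => χ n q.2 * K q.1 q.2) m := fun n =>
    integrable_mul_cutoff hd.contK (hχ n).1.continuous (hχ n).2.1 ha
  have hTK : Tendsto (fun n => ENNReal.ofReal (∫ t in a..b, ∫ x, χ n x * K t x)) atTop
      (𝓝 (∫⁻ q, ENNReal.ofReal (skewFisher M μ ν q.1 q.2) ∂m)) := by
    have e : ∀ n, ENNReal.ofReal (∫ t in a..b, ∫ x, χ n x * K t x) =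
        ∫⁻ q, ENNReal.ofReal (χ n q.2 * K q.1 q.2) ∂m := by
      intro n
      rw [intervalIntegral.integral_of_le hab, ← integral_prod _ (hKint n)]
      refine ofReal_integral_eq_lintegral_ofReal (hKint n) (hpos.mono fun q hq => ?_)
      exact mul_nonneg ((hχ n).2.2.1 _).1 (hKpos _ hq _)
    simp_rw [e]
    refine tendsto_lintegral_of_le_of_tendsto
      (fun n => (hKint n).aestronglyMeasurable.aemeasurable.ennreal_ofReal)
      (fun n => hpos.mono fun q hq => ENNReal.ofReal_le_ofReal ?_)
      (hpos.mono fun q hq => ENNReal.tendsto_ofReal ?_)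
    · rw [← hK _ hq]
      exact mul_le_of_le_one_left (hKpos _ hq _) ((hχ n).2.2.1 _).2
    · rw [← hK _ hq]
      simpa using (hχlim q.2).mul_const (K q.1 q.2)
  -- The mass of `skewDiv` is at most `2(1 + M)` at every time, against a Laplacian of order `(n +
  -- 1)⁻²`.
  have hE : Tendsto (fun n => ∫ t in a..b, ∫ x, coordLaplacian (χ n) x * h t x) atTop (𝓝 0) := by
    have hbd : ∀ n : ℕ, ‖∫ t in a..b, ∫ x, coordLaplacian (χ n) x * h t x‖ ≤
        (C * (((n : ℝ) + 1)⁻¹) ^ 2) * ((1 + M) * 2) * |b - a| := by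
      intro n
      refine intervalIntegral.norm_integral_le_of_norm_le_const fun t ht => ?_
      rw [uIoc_of_le hab] at ht
      have ht0 : 0 < t := ha.trans ht.1
      have hC0 : 0 ≤ C * (((n : ℝ) + 1)⁻¹) ^ 2 := (abs_nonneg _).trans ((hχ n).2.2.2.1 0)
      calc ‖∫ x, coordLaplacian (χ n) x * h t x‖
          ≤ ∫ x, (C * (((n : ℝ) + 1)⁻¹) ^ 2) * h t x := by
            refine norm_integral_le_of_norm_le ((integrable_skewDiv_heatFlow hM ht0).const_mul _)
              (ae_of_all _ fun x => ?_)
            rw [norm_mul, Real.norm_of_nonneg (skewDiv_heatFlow_nonneg hM ht0 x)]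
            exact mul_le_mul_of_nonneg_right ((hχ n).2.2.2.1 x) (skewDiv_heatFlow_nonneg hM ht0 x)
        _ ≤ _ := by
            rw [integral_const_mul]
            exact mul_le_mul_of_nonneg_left (integral_skewDiv_heatFlow_le hM ht0) hC0
    refine squeeze_zero_norm hbd ?_
    have h0 : Tendsto (fun n : ℕ => ((n : ℝ) + 1)⁻¹) atTop (𝓝 0) := by
      simpa using tendsto_one_div_add_atTop_nhds_zero_nat (𝕜 := ℝ)
    have := (((h0.pow 2).const_mul C).mul_const ((1 + M) * 2)).mul_const |b - a|
    simpa using this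
  -- The signed cutoff error is kept with the term at time `a`, whose limit is finite, so its limit
  -- can be taken in `ℝ`; the other side is a sum of nonnegative terms.
  have hA : Tendsto (fun n => ENNReal.ofReal ((∫ x, χ n x * h a x) +
      1 / 2 * ∫ t in a..b, ∫ x, coordLaplacian (χ n) x * h t x)) atTop
      (𝓝 (∫⁻ x, ENNReal.ofReal (h a x))) := by
    have hfin : ∫⁻ x, ENNReal.ofReal (h a x) ≠ ∞ :=
      (integrable_skewDiv_heatFlow hM ha).lintegral_lt_top.ne
    have h1 := (ENNReal.tendsto_toReal hfin).comp (hT a ha)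
    have h2 : Tendsto (fun n => ∫ x, χ n x * h a x) atTop
        (𝓝 (∫⁻ x, ENNReal.ofReal (h a x)).toReal) := by
      refine h1.congr fun n => ENNReal.toReal_ofReal (integral_nonneg fun x => ?_)
      exact mul_nonneg ((hχ n).2.2.1 x).1 (skewDiv_heatFlow_nonneg hM ha x)
    have h3 := ENNReal.tendsto_ofReal (h2.add (hE.const_mul (1 / 2)))
    simpa [ENNReal.ofReal_toReal hfin] using h3
  have hB := (hT b hb).add (ENNReal.Tendsto.const_mul hTK
    (Or.inr (ENNReal.ofReal_ne_top (r := 1 / 2))))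
  refine tendsto_nhds_unique hA (hB.congr fun n => ?_)
  have key := hd.integral_cutoff_sub (hχ n).1 (hχ n).2.1 ha hab
  have hC0 : 0 ≤ ∫ t in a..b, ∫ x, χ n x * K t x := by
    refine intervalIntegral.integral_nonneg hab fun t ht => integral_nonneg fun x => ?_
    exact mul_nonneg ((hχ n).2.2.1 x).1 (hKpos t (ha.trans_le ht.1) x)
  have hB0 : 0 ≤ ∫ x, χ n x * h b x := integral_nonneg fun x =>
    mul_nonneg ((hχ n).2.2.1 x).1 (skewDiv_heatFlow_nonneg hM hb x)
  rw [← ENNReal.ofReal_mul (by norm_num), ← ENNReal.ofReal_add hB0 (by positivity)]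
  congr 1
  linarith

lemma tendsto_lintegral_skewDiv {M : ℝ} (hM : 0 < M) :
    Tendsto (fun n : ℕ => ∫⁻ x, ENNReal.ofReal
      (skewDiv M (heatFlow μ ((n : ℝ) + 1) x) (heatFlow ν ((n : ℝ) + 1) x))) atTop (𝓝 0) := by
  have h := ENNReal.Tendsto.const_mul (tendsto_lintegral_abs_heatFlow_sub μ ν)
    (Or.inr (ENNReal.ofReal_ne_top (r := 1 + M)))
  rw [mul_zero] at h
  refine tendsto_of_tendsto_of_tendsto_of_le_of_le tendsto_const_nhds h (fun n => zero_le)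
    fun n => ?_
  have hn : (0 : ℝ) < n + 1 := by positivity
  dsimp only
  have hmeas : Measurable (fun x => ENNReal.ofReal
      |heatFlow μ ((n : ℝ) + 1) x - heatFlow ν ((n : ℝ) + 1) x|) :=
    ((continuous_heatFlow hn).measurable.sub
      (continuous_heatFlow hn).measurable).abs.ennreal_ofReal
  rw [← lintegral_const_mul _ hmeas]
  refine lintegral_mono fun x => ?_
  rw [← ENNReal.ofReal_mul (by positivity)]
  exact ENNReal.ofReal_le_ofReal (skewDiv_le_abs hM (heatFlow_pos hn x) (heatFlow_pos hn x))

lemma ae_pos_prod {a : ℝ} (ha : 0 ≤ a) :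
    ∀ᵐ q ∂((volume.restrict (Ioi a)).prod (volume : Measure (Latent D))), 0 < q.1 := by
  have h0 : ∀ᵐ t ∂((volume : Measure ℝ).restrict (Ioi a)), 0 < t :=
    (ae_restrict_mem measurableSet_Ioi).mono fun t ht => ha.trans_lt ht
  exact Measure.quasiMeasurePreserving_fst.ae h0

lemma tendsto_lintegral_Ioc_Ioi (F : ℝ × Latent D → ℝ≥0∞) (hF : Measurable F) (a : ℝ) :
    Tendsto (fun n : ℕ => ∫⁻ q, F q ∂((volume.restrict (Ioc a (n + 1))).prod volume)) atTop
      (𝓝 (∫⁻ q, F q ∂((volume.restrict (Ioi a)).prod volume))) := by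
  have e : ∀ n : ℕ, ∫⁻ q, F q ∂((volume.restrict (Ioc a (n + 1))).prod volume) =
      ∫⁻ q, (Iic ((n : ℝ) + 1) ×ˢ univ).indicator F q
        ∂((volume.restrict (Ioi a)).prod volume) := by
    intro n
    rw [lintegral_indicator (measurableSet_Iic.prod MeasurableSet.univ), ← Measure.prod_restrict,
      Measure.restrict_univ, Measure.restrict_restrict measurableSet_Iic, inter_comm,
      Ioi_inter_Iic]
  simp_rw [e]
  refine tendsto_lintegral_of_le_of_tendsto
    (fun n => (hF.indicator (measurableSet_Iic.prod MeasurableSet.univ)).aemeasurable)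
    (fun n => ae_of_all _ fun q => indicator_le_self _ _ _) (ae_of_all _ fun q => ?_)
  refine tendsto_const_nhds.congr' ?_
  obtain ⟨N, hN⟩ := exists_nat_ge q.1
  filter_upwards [eventually_ge_atTop N] with n hn
  rw [indicator_of_mem]
  have : (N : ℝ) ≤ n := by exact_mod_cast hn
  exact ⟨by simp only [mem_Iic]; linarith, trivial⟩

lemma lintegral_skewDiv_eq {M : ℝ} (hM : 0 < M) {a : ℝ} (ha : 0 < a) :
    ∫⁻ x, ENNReal.ofReal (skewDiv M (heatFlow μ a x) (heatFlow ν a x)) =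
      ENNReal.ofReal (1 / 2) * ∫⁻ q, ENNReal.ofReal (skewFisher M μ ν q.1 q.2)
        ∂((volume.restrict (Ioi a)).prod volume) := by
  have h1 := (tendsto_lintegral_skewDiv (μ := μ) (ν := ν) hM).add
    (ENNReal.Tendsto.const_mul (tendsto_lintegral_Ioc_Ioi _
      (measurable_skewFisher M μ ν).ennreal_ofReal a)
      (Or.inr (ENNReal.ofReal_ne_top (r := 1 / 2))))
  rw [zero_add] at h1
  refine tendsto_nhds_unique (tendsto_const_nhds.congr' ?_) h1
  obtain ⟨N, hN⟩ := exists_nat_ge a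
  filter_upwards [eventually_ge_atTop N] with n hn
  have : (N : ℝ) ≤ n := by exact_mod_cast hn
  exact lintegral_skewDiv_eq_add hM ha (by linarith)

/-- De Bruijn's identity for the Kullback-Leibler divergence along the heat flow, integrated from
time `a` to infinity. -/
lemma lintegral_klFun_heatFlow {a : ℝ} (ha : 0 < a) :
    ∫⁻ x, ENNReal.ofReal (heatFlow ν a x * klFun (heatFlow μ a x / heatFlow ν a x)) =
      ENNReal.ofReal (1 / 2) * ∫⁻ q, ENNReal.ofReal (fisherDensity μ ν q.1 q.2)
        ∂((volume.restrict (Ioi a)).prod volume) := by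
  -- The limit `M = n + 1 → ∞` in the identity for `skewDiv`, taken on both sides.
  have h1 : Tendsto (fun n : ℕ => ∫⁻ x, ENNReal.ofReal
      (skewDiv (n + 1) (heatFlow μ a x) (heatFlow ν a x))) atTop
      (𝓝 (∫⁻ x, ENNReal.ofReal (heatFlow ν a x * klFun (heatFlow μ a x / heatFlow ν a x)))) :=
    tendsto_lintegral_of_le_of_tendsto
      (fun n => (measurable_skewDiv_heatFlow _ ha).ennreal_ofReal.aemeasurable)
      (fun n => ae_of_all _ fun x => ENNReal.ofReal_le_ofReal
        (skewDiv_le (by positivity) (heatFlow_pos ha x) (heatFlow_pos ha x)))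
      (ae_of_all _ fun x => ENNReal.tendsto_ofReal
        (tendsto_skewDiv (heatFlow_pos ha x) (heatFlow_pos ha x)))
  have h2 : Tendsto (fun n : ℕ => ∫⁻ q, ENNReal.ofReal (skewFisher (n + 1) μ ν q.1 q.2)
        ∂((volume.restrict (Ioi a)).prod volume)) atTop
      (𝓝 (∫⁻ q, ENNReal.ofReal (fisherDensity μ ν q.1 q.2)
        ∂((volume.restrict (Ioi a)).prod volume))) :=
    tendsto_lintegral_of_le_of_tendsto
      (fun n => (measurable_skewFisher _ μ ν).ennreal_ofReal.aemeasurable)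
      (fun n => (ae_pos_prod ha.le).mono fun q hq => ENNReal.ofReal_le_ofReal
        (skewFisher_le (by positivity) hq _))
      ((ae_pos_prod ha.le).mono fun q hq => ENNReal.tendsto_ofReal (tendsto_skewFisher hq _))
  refine tendsto_nhds_unique h1 ?_
  refine (ENNReal.Tendsto.const_mul h2
    (Or.inr (ENNReal.ofReal_ne_top (r := 1 / 2)))).congr fun n => ?_
  exact (lintegral_skewDiv_eq (by positivity) ha).symm

end

/-! ### The limit of time zero: data processing and lower semicontinuity -/

section

open scoped BoundedContinuousFunction

variable {D : ℕ} {μ ν : Measure (Latent D)} [IsProbabilityMeasure μ] [IsProbabilityMeasure ν]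

/-- Young's inequality: `e^r - 1` is the convex conjugate of `klFun`, with equality at `r = log x`.
It serves both as Jensen's inequality and as the easy half of the dual formula. -/
lemma klFun_ge_tangent {x : ℝ} (hx : 0 ≤ x) (r : ℝ) : r * x - (Real.exp r - 1) ≤ klFun x := by
  rcases hx.eq_or_lt with rfl | hx
  · simp [klFun_zero, (Real.exp_pos r).le]
  · rw [klFun_apply]
    have h := Real.add_one_le_exp (r - Real.log x)
    rw [Real.exp_sub, Real.exp_log hx, le_div_iff₀ hx] at h
    linarith

lemma mul_klFun_div {p q : ℝ} (hp : 0 < p) (hq : 0 < q) :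
    q * klFun (p / q) = Real.log (p / q) * p - (Real.exp (Real.log (p / q)) - 1) * q := by
  rw [klFun_apply, Real.exp_log (by positivity)]
  field_simp
  ring

lemma mul_klFun_div_ge {p q : ℝ} (hp : 0 < p) (hq : 0 < q) (r : ℝ) :
    r * p - (Real.exp r - 1) * q ≤ q * klFun (p / q) := by
  have h := mul_le_mul_of_nonneg_left (klFun_ge_tangent (div_pos hp hq).le r) hq.le
  have e : q * (r * (p / q) - (Real.exp r - 1)) = r * p - (Real.exp r - 1) * q := by field_simp
  linarith

/-- The data processing inequality for the heat flow. -/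
lemma lintegral_klFun_heatFlow_le {a : ℝ} (ha : 0 < a) :
    ∫⁻ x, ENNReal.ofReal (heatFlow ν a x * klFun (heatFlow μ a x / heatFlow ν a x)) ≤
      klDiv μ ν := by
  by_cases hac : μ ≪ ν
  swap; · simp [klDiv_of_not_ac hac]
  rw [klDiv_eq_lintegral_klFun_of_ac hac]
  set L : Latent D → ℝ := fun z => (μ.rnDeriv ν z).toReal with hL
  have hLm : Measurable L := (Measure.measurable_rnDeriv μ ν).ennreal_toReal
  have hmeas : Measurable (fun r : Latent D × Latent D =>
      ENNReal.ofReal (klFun (L r.2)) * ENNReal.ofReal (heatKernel a (r.1 - r.2))) := by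
    have := measurable_klFun
    fun_prop
  calc ∫⁻ x, ENNReal.ofReal (heatFlow ν a x * klFun (heatFlow μ a x / heatFlow ν a x))
      ≤ ∫⁻ x, (∫⁻ z, ENNReal.ofReal (klFun (L z)) * ENNReal.ofReal (heatKernel a (x - z)) ∂ν) := by
        refine lintegral_mono fun x => ?_
        have hG0 : ∀ z, 0 ≤ heatKernel a (x - z) := fun z => (heatKernel_pos ha _).le
        have hk0 : ∀ z, 0 ≤ klFun (L z) := fun z => klFun_nonneg ENNReal.toReal_nonneg
        have e1 : ∀ z, ENNReal.ofReal (klFun (L z)) * ENNReal.ofReal (heatKernel a (x - z)) =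
            ENNReal.ofReal (klFun (L z) * heatKernel a (x - z)) := fun z =>
          (ENNReal.ofReal_mul (hk0 z)).symm
        simp_rw [e1]
        by_cases htop : ∫⁻ z, ENNReal.ofReal (klFun (L z) * heatKernel a (x - z)) ∂ν = ∞
        · rw [htop]; exact le_top
        have hGi := (QuadWeight.const (D := D) 1).integrable (μ := ν) ha x
        simp only [one_mul] at hGi
        have hm2 : Measurable (fun z => klFun (L z) * heatKernel a (x - z)) := by
          have := measurable_klFun
          fun_prop
        have hint : Integrable (fun z => klFun (L z) * heatKernel a (x - z)) ν :=
          (lintegral_ofReal_ne_top_iff_integrable hm2.aestronglyMeasurable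
            (ae_of_all _ fun z => mul_nonneg (hk0 z) (hG0 z))).1 htop
        rw [← ofReal_integral_eq_lintegral_ofReal hint
          (ae_of_all _ fun z => mul_nonneg (hk0 z) (hG0 z))]
        refine ENNReal.ofReal_le_ofReal ?_
        rw [mul_klFun_div (heatFlow_pos ha x) (heatFlow_pos ha x)]
        -- The slope that is exact at the averaged density. The tangent bound at this `r`,
        -- integrated in `z`, is Jensen's inequality.
        set r := Real.log (heatFlow μ a x / heatFlow ν a x)
        have hLG : Integrable (fun z => L z * heatKernel a (x - z)) ν := by
          obtain ⟨C, hC⟩ := (QuadWeight.const (D := D) 1).exists_bound (b := a) ha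
          refine Integrable.mul_bdd (c := C) Measure.integrable_toReal_rnDeriv
            (hGi.aestronglyMeasurable) (ae_of_all _ fun z => ?_)
          simpa using hC a ⟨le_rfl, le_rfl⟩ (x - z)
        have : μ.HaveLebesgueDecomposition ν :=
          Measure.haveLebesgueDecomposition_of_sigmaFinite μ ν
        have e2 : heatFlow μ a x = ∫ z, L z * heatKernel a (x - z) ∂ν := by
          have := integral_rnDeriv_smul hac (f := fun z => heatKernel a (x - z))
          simp only [smul_eq_mul] at this
          rw [hL, this]
          simp [heatFlow, heatMoment]
        have e3 : heatFlow ν a x = ∫ z, heatKernel a (x - z) ∂ν := by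
          simp [heatFlow, heatMoment]
        rw [e2, e3, ← integral_const_mul, ← integral_const_mul,
          ← integral_sub (hLG.const_mul _) (hGi.const_mul _)]
        refine integral_mono ((hLG.const_mul _).sub (hGi.const_mul _)) hint fun z => ?_
        have := mul_le_mul_of_nonneg_right
          (klFun_ge_tangent (x := L z) ENNReal.toReal_nonneg r) (hG0 z)
        dsimp only [Pi.sub_apply]
        linarith
    _ = ∫⁻ z, (∫⁻ x, ENNReal.ofReal (klFun (L z)) * ENNReal.ofReal (heatKernel a (x - z))) ∂ν :=
        lintegral_lintegral_swap hmeas.aemeasurable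
    _ = ∫⁻ z, ENNReal.ofReal (klFun (L z)) ∂ν := by
        refine lintegral_congr fun z => ?_
        rw [lintegral_const_mul _ (by fun_prop), lintegral_heatKernel ha, mul_one]

lemma withDensity_heatFlow (μ : Measure (Latent D)) [IsFiniteMeasure μ] {t : ℝ} (ht : 0 < t) :
    volume.withDensity (fun y => ENNReal.ofReal (heatFlow μ t y)) =
      (μ.prod (stdGaussian (Latent D))).map (fun w => w.1 + √t • w.2) := by
  have hu : Measurable (heatFlow μ t) :=
    (continuous_section continuousOn_heatFlow ht).measurable
  ext s hs
  rw [withDensity_apply _ hs, Measure.map_apply (by fun_prop) hs, ← lintegral_indicator hs,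
    ← lintegral_indicator_one (hs.preimage (by fun_prop)), lintegral_prod _
    (Measurable.aemeasurable (measurable_one.indicator (hs.preimage (by fun_prop))))]
  have h := lintegral_mul_heatFlow μ ht (s.indicator 1) (measurable_one.indicator hs)
  refine Eq.trans (lintegral_congr fun y => ?_) (h.trans rfl)
  by_cases hy : y ∈ s <;> simp [hy]

lemma integral_mul_heatFlow (f : Latent D → ℝ) (hf : Continuous f) {t : ℝ} (ht : 0 < t) :
    ∫ y, f y * heatFlow μ t y =
      ∫ w, f (w.1 + √t • w.2) ∂(μ.prod (stdGaussian (Latent D))) := by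
  have h := integral_map (μ := μ.prod (stdGaussian (Latent D))) (φ := fun w => w.1 + √t • w.2)
    (by fun_prop) (f := f) hf.aestronglyMeasurable
  rw [← h, ← withDensity_heatFlow μ ht, integral_withDensity_eq_integral_toReal_smul₀
    (continuous_heatFlow ht).measurable.ennreal_ofReal.aemeasurable (by simp)]
  refine integral_congr_ae (ae_of_all _ fun y => ?_)
  simp only [smul_eq_mul]
  rw [ENNReal.toReal_ofReal (heatFlow_pos ht y).le, mul_comm]

/-- On the coupling `(z, ε)` the points `z + √t ε` converge to `z` pointwise, and `f` is bounded. -/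
lemma tendsto_integral_mul_heatFlow (f : Latent D → ℝ) (hf : Continuous f) {C : ℝ}
    (hC : ∀ x, |f x| ≤ C) :
    Tendsto (fun n : ℕ => ∫ y, f y * heatFlow μ (1 / ((n : ℝ) + 1)) y) atTop
      (𝓝 (∫ z, f z ∂μ)) := by
  have h0 : ∫ z, f z ∂μ = ∫ w, f w.1 ∂(μ.prod (stdGaussian (Latent D))) := by
    rw [integral_fun_fst]; simp
  have e : ∀ n : ℕ, ∫ y, f y * heatFlow μ (1 / ((n : ℝ) + 1)) y =
      ∫ w, f (w.1 + √(1 / ((n : ℝ) + 1)) • w.2) ∂(μ.prod (stdGaussian (Latent D))) := fun n =>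
    integral_mul_heatFlow f hf (by positivity)
  simp_rw [e]
  rw [h0]
  refine tendsto_integral_of_dominated_convergence (fun _ => C) (fun n => ?_) (integrable_const _)
    (fun n => ae_of_all _ fun w => hC _) (ae_of_all _ fun w => ?_)
  · exact (hf.comp (by fun_prop)).aestronglyMeasurable
  · refine (hf.tendsto _).comp ?_
    have h1 : Tendsto (fun n : ℕ => √(1 / ((n : ℝ) + 1))) atTop (𝓝 0) := by
      simpa using (tendsto_one_div_add_atTop_nhds_zero_nat (𝕜 := ℝ)).sqrt
    simpa using (tendsto_const_nhds (x := w.1)).add (h1.smul_const w.2)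

omit [IsProbabilityMeasure μ] [IsProbabilityMeasure ν] in
lemma abs_max_min_sub_le {B x y : ℝ} (hx : |x| ≤ B) : |x - max (-B) (min B y)| ≤ |x - y| := by
  rw [abs_le] at hx
  have h : x = max (-B) (min B x) := by rw [min_eq_right hx.2, max_eq_right hx.1]
  calc |x - max (-B) (min B y)| = |max (-B) (min B x) - max (-B) (min B y)| := by rw [← h]
    _ ≤ |min B x - min B y| := by
        simpa using abs_max_sub_max_le_max (-B) (min B x) (-B) (min B y)
    _ ≤ |x - y| := by simpa using abs_min_sub_min_le_max B x B y

lemma abs_exp_sub_exp_le {B x y : ℝ} (hx : |x| ≤ B) (hy : |y| ≤ B) :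
    |Real.exp x - Real.exp y| ≤ Real.exp B * |x - y| := by
  wlog h : y ≤ x generalizing x y
  · rw [abs_sub_comm, abs_sub_comm x]
    exact this hy hx (le_of_not_ge h)
  rw [abs_of_nonneg (by simpa using h), abs_of_nonneg (by linarith)]
  have h1 := Real.add_one_le_exp (y - x)
  have h2 := mul_le_mul_of_nonneg_left h1 (Real.exp_pos x).le
  rw [← Real.exp_add, add_sub_cancel] at h2
  have h3 : Real.exp x ≤ Real.exp B := Real.exp_le_exp.2 ((le_abs_self x).trans hx)
  have h4 := mul_le_mul_of_nonneg_right h3 (sub_nonneg.2 h)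
  linarith

omit [IsProbabilityMeasure ν] in
lemma integrable_of_measurable_of_abs_le [IsFiniteMeasure ν] {g : Latent D → ℝ}
    (hg : Measurable g) {B : ℝ} (hB : ∀ x, |g x| ≤ B) : Integrable g ν :=
  Integrable.of_bound hg.aestronglyMeasurable B (ae_of_all _ hB)

/-- A dual bound on bounded continuous functions extends to bounded measurable functions. -/
lemma dual_bound_of_measurable {c : ℝ}
    (H : ∀ (g : Latent D → ℝ) (B : ℝ), Continuous g → (∀ x, |g x| ≤ B) →
      ∫ x, g x ∂μ - ∫ x, (Real.exp (g x) - 1) ∂ν ≤ c)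
    {g : Latent D → ℝ} (hg : Measurable g) {B : ℝ} (hB : ∀ x, |g x| ≤ B) :
    ∫ x, g x ∂μ - ∫ x, (Real.exp (g x) - 1) ∂ν ≤ c := by
  have hB0 : 0 ≤ B := (abs_nonneg _).trans (hB 0)
  refine le_of_forall_pos_le_add fun ε hε => ?_
  -- Approximation in `L¹(μ + ν)` is close for both laws at once. The linear term counts the error
  -- once and the exponential one `e^B` times, whence the denominator.
  obtain ⟨h, hh, hhi⟩ := (integrable_of_measurable_of_abs_le (ν := μ + ν) hg
    hB).exists_boundedContinuous_integral_sub_le (ε := ε / (1 + Real.exp B)) (by positivity)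
  -- Clamping keeps the continuous approximant in the range where `exp` has Lipschitz constant
  -- `e^B`, and brings it no farther from `g`.
  set k : Latent D → ℝ := fun x => max (-B) (min B (h x)) with hk
  have hkc : Continuous k := by have := h.continuous; fun_prop
  have hkB : ∀ x, |k x| ≤ B := fun x =>
    abs_le.2 ⟨le_max_left _ _, max_le (by linarith) (min_le_left _ _)⟩
  have hd : ∀ x, |g x - k x| ≤ |g x - h x| := fun x => abs_max_min_sub_le (hB x)
  have hexp : ∀ f : Latent D → ℝ, Measurable f → (∀ x, |f x| ≤ B) →
      Integrable (fun x => Real.exp (f x) - 1) ν := by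
    intro f hf hfB
    refine (integrable_of_measurable_of_abs_le (B := Real.exp B) (by fun_prop) fun x => ?_).sub
      (integrable_const 1)
    rw [abs_of_pos (Real.exp_pos _)]
    exact Real.exp_le_exp.2 ((le_abs_self _).trans (hfB x))
  have hgi : ∀ (ρ : Measure (Latent D)) [IsFiniteMeasure ρ], Integrable g ρ := fun ρ _ =>
    integrable_of_measurable_of_abs_le hg hB
  have hki : ∀ (ρ : Measure (Latent D)) [IsFiniteMeasure ρ], Integrable k ρ := fun ρ _ =>
    integrable_of_measurable_of_abs_le hkc.measurable hkB
  have hgh : Integrable (fun x => |g x - h x|) (μ + ν) := ((hgi _).sub hhi).abs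
  have hghμ := hgh.left_of_add_measure
  have hghν := hgh.right_of_add_measure
  have h1 : ∫ x, g x ∂μ - ∫ x, k x ∂μ ≤ ∫ x, |g x - h x| ∂μ := by
    rw [← integral_sub (hgi μ) (hki μ)]
    exact integral_mono ((hgi μ).sub (hki μ)) hghμ fun x => (le_abs_self _).trans (hd x)
  have h2 : (∫ x, (Real.exp (k x) - 1) ∂ν) - ∫ x, (Real.exp (g x) - 1) ∂ν ≤
      Real.exp B * ∫ x, |g x - h x| ∂ν := by
    rw [← integral_sub (hexp k hkc.measurable hkB) (hexp g hg hB), ← integral_const_mul]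
    refine integral_mono ((hexp k hkc.measurable hkB).sub (hexp g hg hB)) (hghν.const_mul _)
      fun x => ?_
    have h3 := (le_abs_self _).trans (abs_exp_sub_exp_le (hkB x) (hB x))
    rw [abs_sub_comm] at h3
    have h4 := mul_le_mul_of_nonneg_left (hd x) (Real.exp_pos B).le
    dsimp only
    linarith
  have h5 : ∫ x, |g x - h x| ∂μ + ∫ x, |g x - h x| ∂ν ≤ ε / (1 + Real.exp B) := by
    rw [← integral_add_measure hghμ hghν]
    exact hh
  have h6 := H k B hkc hkB
  have h7 : 0 ≤ ∫ x, |g x - h x| ∂μ := integral_nonneg fun _ => abs_nonneg _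
  have h8 : 0 ≤ ∫ x, |g x - h x| ∂ν := integral_nonneg fun _ => abs_nonneg _
  rw [le_div_iff₀ (by positivity)] at h5
  have h9 := mul_nonneg (Real.exp_pos B).le h7
  linarith

/-- The half of the Donsker-Varadhan formula that bounds the Kullback-Leibler divergence from
above by its dual form on bounded continuous functions. -/
lemma klDiv_le_of_dual_bound {c : ℝ}
    (H : ∀ (g : Latent D → ℝ) (B : ℝ), Continuous g → (∀ x, |g x| ≤ B) →
      ∫ x, g x ∂μ - ∫ x, (Real.exp (g x) - 1) ∂ν ≤ c) :
    klDiv μ ν ≤ ENNReal.ofReal c := by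
  have H' := fun (g : Latent D → ℝ) (hg : Measurable g) (B : ℝ) (hB : ∀ x, |g x| ≤ B) =>
    dual_bound_of_measurable H hg hB
  have hac : μ ≪ ν := by
    refine Measure.AbsolutelyContinuous.mk fun s hs hνs => ?_
    -- The test function `n · 1_s` has zero exponential cost on a `ν`-null set, so `μ s` must
    -- vanish.
    have h1 : ∀ n : ℕ, n * μ.real s ≤ c := by
      intro n
      have h2 := H' (s.indicator fun _ => (n : ℝ)) (measurable_const.indicator hs) n fun x => by
        by_cases hx : x ∈ s <;> simp [hx]
      have h3 : ∫ x, (Real.exp (s.indicator (fun _ => (n : ℝ)) x) - 1) ∂ν = 0 := by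
        refine integral_eq_zero_of_ae ?_
        have h4 : ∀ᵐ x ∂ν, x ∉ s := measure_eq_zero_iff_ae_notMem.1 hνs
        filter_upwards [h4] with x hx
        simp [hx]
      rw [h3, integral_indicator_const _ hs, sub_zero, smul_eq_mul, mul_comm] at h2
      exact h2
    by_contra hne
    have hpos : 0 < μ.real s := by
      rw [measureReal_def]
      exact ENNReal.toReal_pos hne (measure_ne_top _ _)
    obtain ⟨n, hn⟩ := exists_nat_gt (c / μ.real s)
    rw [div_lt_iff₀ hpos] at hn
    exact absurd (h1 n) (not_le.2 hn)
  rw [klDiv_eq_lintegral_klFun_of_ac hac]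
  set L : Latent D → ℝ := fun z => (μ.rnDeriv ν z).toReal with hL
  have hLm : Measurable L := (Measure.measurable_rnDeriv μ ν).ennreal_toReal
  have hL0 : ∀ x, 0 ≤ L x := fun x => ENNReal.toReal_nonneg
  -- The optimal test function `log L` may be unbounded; clamping `L` away from zero and infinity
  -- makes its logarithm admissible.
  set k : ℕ → Latent D → ℝ := fun n x => max (1 / ((n : ℝ) + 1)) (min (n + 1) (L x)) with hk
  have hkm : ∀ n, Measurable (k n) := fun n => by fun_prop
  have hk1 : ∀ (n : ℕ) x, 1 / ((n : ℝ) + 1) ≤ k n x := fun n x => le_max_left _ _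
  have hkpos : ∀ n x, 0 < k n x := fun n x => lt_of_lt_of_le (by positivity) (hk1 n x)
  have hinv : ∀ n : ℕ, 1 / ((n : ℝ) + 1) ≤ 1 := fun n => by
    rw [div_le_one (by positivity)]; linarith [(n.cast_nonneg : (0 : ℝ) ≤ n)]
  have hk2 : ∀ (n : ℕ) x, k n x ≤ n + 1 := fun n x => max_le
    ((hinv n).trans (by linarith [(n.cast_nonneg : (0 : ℝ) ≤ n)])) (min_le_left _ _)
  set φ : ℕ → Latent D → ℝ := fun n x => L x * Real.log (k n x) - (k n x - 1) with hφ
  have hlogB : ∀ (n : ℕ) x, |Real.log (k n x)| ≤ Real.log (n + 1) := by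
    intro n x
    rw [abs_le]
    constructor
    · rw [← Real.log_inv, ← one_div]
      exact Real.log_le_log (by positivity) (hk1 n x)
    · exact Real.log_le_log (hkpos n x) (hk2 n x)
  have hφ0 : ∀ n x, 0 ≤ φ n x := by
    intro n x
    -- `φ = (L - k) log k + klFun k`. The clamping interval contains `1`, so `L < k` forces `k ≤ 1`
    -- and `L > k` forces `k ≥ 1`. Nonnegativity of `φ` is what allows Fatou below.
    have h1 : 0 ≤ (L x - k n x) * Real.log (k n x) := by
      rcases le_total (L x) (k n x) with h | h
      · rcases h.eq_or_lt with h | h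
        · simp [h]
        · have h2 : k n x ≤ 1 := by
            rcases le_total (min ((n : ℝ) + 1) (L x)) (1 / ((n : ℝ) + 1)) with h3 | h3
            · simp only [hk, max_eq_left h3]; exact hinv n
            · simp only [hk, max_eq_right h3] at h
              exact absurd (min_le_right _ _) (not_le.2 h)
          exact mul_nonneg_of_nonpos_of_nonpos (by linarith)
            (Real.log_nonpos (hkpos n x).le h2)
      · rcases h.eq_or_lt with h | h
        · simp [h]
        · have h2 : 1 ≤ k n x := by
            rcases le_total ((n : ℝ) + 1) (L x) with h3 | h3
            · refine le_trans ?_ (le_max_right _ _)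
              rw [min_eq_left h3]; linarith [(n.cast_nonneg : (0 : ℝ) ≤ n)]
            · simp only [hk, min_eq_right h3] at h
              exact absurd (le_max_right _ _) (not_le.2 h)
          exact mul_nonneg (by linarith) (Real.log_nonneg h2)
    have h3 := klFun_nonneg (hkpos n x).le
    rw [klFun_apply] at h3
    simp only [hφ]
    linarith
  have hφm : ∀ n, Measurable (φ n) := fun n => by fun_prop
  have hφlim : ∀ x, Tendsto (fun n => φ n x) atTop (𝓝 (klFun (L x))) := by
    intro x
    rcases (hL0 x).eq_or_lt with h | h
    · have e : ∀ n, φ n x = 1 - 1 / ((n : ℝ) + 1) := by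
        intro n
        have : k n x = 1 / ((n : ℝ) + 1) := by
          simp only [hk, ← h]
          rw [min_eq_right (by positivity), max_eq_left (by positivity)]
        simp only [hφ, this, ← h]
        ring
      simp_rw [e, ← h, klFun_zero]
      simpa using (tendsto_const_nhds (x := (1 : ℝ))).sub
        (tendsto_one_div_add_atTop_nhds_zero_nat (𝕜 := ℝ))
    · refine tendsto_const_nhds.congr' ?_
      obtain ⟨N, hN⟩ := exists_nat_ge (L x)
      obtain ⟨N', hN'⟩ := exists_nat_one_div_lt h
      filter_upwards [eventually_ge_atTop N, eventually_ge_atTop N'] with n hn hn'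
      have h1 : (N : ℝ) ≤ n := by exact_mod_cast hn
      have h2 : (N' : ℝ) ≤ n := by exact_mod_cast hn'
      have h3 : 1 / ((n : ℝ) + 1) ≤ 1 / ((N' : ℝ) + 1) := by gcongr
      have h4 : k n x = L x := by
        simp only [hk]
        rw [min_eq_right (by linarith), max_eq_right (by linarith)]
      simp only [hφ, h4, klFun_apply]
      ring
  have hφc : ∀ n, ∫⁻ x, ENNReal.ofReal (φ n x) ∂ν ≤ ENNReal.ofReal c := by
    intro n
    have hlm : Measurable (fun x => Real.log (k n x)) := by fun_prop
    have h1 := H' (fun x => Real.log (k n x)) hlm _ (hlogB n)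
    have h2 : Integrable (fun x => L x * Real.log (k n x)) ν :=
      Integrable.mul_bdd (c := Real.log (n + 1)) Measure.integrable_toReal_rnDeriv
        hlm.aestronglyMeasurable (ae_of_all _ (hlogB n))
    have h3 : Integrable (fun x => k n x - 1) ν :=
      (integrable_of_measurable_of_abs_le (hkm n) fun x => by
        rw [abs_of_pos (hkpos n x)]; exact hk2 n x).sub (integrable_const 1)
    have h5 : Integrable (φ n) ν := h2.sub h3
    rw [← ofReal_integral_eq_lintegral_ofReal h5 (ae_of_all _ (hφ0 n))]
    refine ENNReal.ofReal_le_ofReal ?_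
    have : μ.HaveLebesgueDecomposition ν := Measure.haveLebesgueDecomposition_of_sigmaFinite μ ν
    have h4 := integral_rnDeriv_smul hac (f := fun x => Real.log (k n x))
    simp only [smul_eq_mul] at h4
    have h6 : ∫ x, φ n x ∂ν = ∫ x, L x * Real.log (k n x) ∂ν - ∫ x, (k n x - 1) ∂ν :=
      integral_sub h2 h3
    rw [h6]
    rw [← h4] at h1
    simp_rw [Real.exp_log (hkpos n _)] at h1
    exact h1
  have hlim : Tendsto (fun n => ENNReal.ofReal c) (atTop : Filter ℕ) (𝓝 (ENNReal.ofReal c)) :=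
    tendsto_const_nhds
  calc ∫⁻ x, ENNReal.ofReal (klFun (L x)) ∂ν
      = ∫⁻ x, liminf (fun n => ENNReal.ofReal (φ n x)) atTop ∂ν :=
        lintegral_congr fun x => (ENNReal.tendsto_ofReal (hφlim x)).liminf_eq.symm
    _ ≤ liminf (fun n => ∫⁻ x, ENNReal.ofReal (φ n x) ∂ν) atTop :=
        lintegral_liminf_le fun n => (hφm n).ennreal_ofReal
    _ ≤ liminf (fun _ : ℕ => ENNReal.ofReal c) atTop :=
        liminf_le_liminf (Eventually.of_forall hφc)
    _ = ENNReal.ofReal c := hlim.liminf_eq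

/-- Lower semicontinuity of the Kullback-Leibler divergence along the heat flow. -/
lemma klDiv_le_of_forall_heatFlow_le {C : ℝ≥0∞}
    (hC : ∀ a, 0 < a → ∫⁻ x, ENNReal.ofReal
      (heatFlow ν a x * klFun (heatFlow μ a x / heatFlow ν a x)) ≤ C) : klDiv μ ν ≤ C := by
  by_cases hCt : C = ∞
  · rw [hCt]; exact le_top
  rw [← ENNReal.ofReal_toReal hCt]
  refine klDiv_le_of_dual_bound fun g B hg hB => ?_
  have he : ∀ x, |Real.exp (g x) - 1| ≤ Real.exp B + 1 := fun x => by
    refine (abs_sub _ _).trans ?_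
    rw [abs_of_pos (Real.exp_pos _), abs_one]
    gcongr
    exact (le_abs_self _).trans (hB x)
  have hec : Continuous (fun x => Real.exp (g x) - 1) := by fun_prop
  have hlim := (tendsto_integral_mul_heatFlow (μ := μ) g hg hB).sub
    (tendsto_integral_mul_heatFlow (μ := ν) _ hec he)
  -- For fixed `g` the dual functional is continuous along the flow, so it suffices to bound it by
  -- `C` at each positive time, where Young's inequality applies to the densities.
  refine le_of_tendsto hlim (Eventually.of_forall fun n => ?_)
  have hn : (0 : ℝ) < 1 / ((n : ℝ) + 1) := by positivity
  set a := 1 / ((n : ℝ) + 1)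
  have hi : ∀ (ρ : Measure (Latent D)) [IsProbabilityMeasure ρ] (f : Latent D → ℝ) (K : ℝ),
      Continuous f → (∀ x, |f x| ≤ K) → Integrable (fun x => f x * heatFlow ρ a x) :=
    fun ρ _ f K hf hK => (integrable_heatFlow hn).bdd_mul hf.aestronglyMeasurable
      (ae_of_all _ hK)
  have hkl0 : ∀ x, 0 ≤ heatFlow ν a x * klFun (heatFlow μ a x / heatFlow ν a x) := fun x =>
    mul_nonneg (heatFlow_pos hn x).le
      (klFun_nonneg (div_pos (heatFlow_pos hn x) (heatFlow_pos hn x)).le)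
  have hklm : Measurable (fun x => heatFlow ν a x * klFun (heatFlow μ a x / heatFlow ν a x)) :=
    (continuous_heatFlow hn).measurable.mul (measurable_klFun.comp
      ((continuous_heatFlow hn).measurable.div (continuous_heatFlow hn).measurable))
  have hne : ∫⁻ x, ENNReal.ofReal
      (heatFlow ν a x * klFun (heatFlow μ a x / heatFlow ν a x)) ≠ ∞ :=
    ne_top_of_le_ne_top hCt (hC a hn)
  have hkli := (lintegral_ofReal_ne_top_iff_integrable hklm.aestronglyMeasurable
    (ae_of_all _ hkl0)).1 hne
  calc (∫ y, g y * heatFlow μ a y) - ∫ y, (Real.exp (g y) - 1) * heatFlow ν a y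
      = ∫ y, (g y * heatFlow μ a y - (Real.exp (g y) - 1) * heatFlow ν a y) :=
        (integral_sub (hi μ g B hg hB) (hi ν _ _ hec he)).symm
    _ ≤ ∫ y, heatFlow ν a y * klFun (heatFlow μ a y / heatFlow ν a y) :=
        integral_mono ((hi μ g B hg hB).sub (hi ν _ _ hec he)) hkli fun y =>
          mul_klFun_div_ge (heatFlow_pos hn y) (heatFlow_pos hn y) (g y)
    _ ≤ C.toReal := by
        rw [integral_eq_lintegral_of_nonneg_ae (ae_of_all _ hkl0) hklm.aestronglyMeasurable]
        exact ENNReal.toReal_mono hCt (hC a hn)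

/-- The Kullback-Leibler divergence as an integral of relative Fisher informations. -/
lemma klDiv_eq_lintegral_fisherDensity (μ ν : Measure (Latent D)) [IsProbabilityMeasure μ]
    [IsProbabilityMeasure ν] :
    klDiv μ ν = ENNReal.ofReal (1 / 2) * ∫⁻ q, ENNReal.ofReal (fisherDensity μ ν q.1 q.2)
        ∂((volume.restrict (Ioi 0)).prod volume) := by
  have hF : Measurable (fun q : ℝ × Latent D => ENNReal.ofReal (fisherDensity μ ν q.1 q.2)) :=
    (measurable_fisherDensity μ ν).ennreal_ofReal
  have hind : ∀ a : ℝ, 0 ≤ a → ∫⁻ q, ENNReal.ofReal (fisherDensity μ ν q.1 q.2)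
      ∂((volume.restrict (Ioi a)).prod volume) = ∫⁻ q, (Ioi a ×ˢ univ).indicator
      (fun q : ℝ × Latent D => ENNReal.ofReal (fisherDensity μ ν q.1 q.2)) q
        ∂((volume.restrict (Ioi 0)).prod volume) := by
    intro a ha
    rw [lintegral_indicator (measurableSet_Ioi.prod MeasurableSet.univ), ← Measure.prod_restrict,
      Measure.restrict_univ, Measure.restrict_restrict measurableSet_Ioi,
      inter_eq_left.2 (Ioi_subset_Ioi ha)]
  apply le_antisymm
  -- At each time `a` the divergence is the Fisher integral over `(a, ∞)`, at most the full one.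
  · refine klDiv_le_of_forall_heatFlow_le fun a ha => ?_
    rw [lintegral_klFun_heatFlow ha]
    gcongr
  · have h1 : Tendsto (fun n : ℕ => ∫⁻ q, ENNReal.ofReal (fisherDensity μ ν q.1 q.2)
        ∂((volume.restrict (Ioi (1 / ((n : ℝ) + 1)))).prod volume)) atTop
        (𝓝 (∫⁻ q, ENNReal.ofReal (fisherDensity μ ν q.1 q.2)
          ∂((volume.restrict (Ioi 0)).prod volume))) := by
      simp_rw [fun n : ℕ => hind (1 / ((n : ℝ) + 1)) (by positivity)]
      refine tendsto_lintegral_of_le_of_tendsto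
        (fun n => (hF.indicator (measurableSet_Ioi.prod MeasurableSet.univ)).aemeasurable)
        (fun n => ae_of_all _ fun q => indicator_le_self _ _ _)
        ((ae_pos_prod le_rfl).mono fun q hq => ?_)
      refine tendsto_const_nhds.congr' ?_
      filter_upwards [(tendsto_one_div_add_atTop_nhds_zero_nat (𝕜 := ℝ)).eventually_lt_const hq]
        with n hn
      rw [indicator_of_mem]
      exact ⟨hn, trivial⟩
    -- Conversely, by data processing, every truncated Fisher integral is at most the divergence at
    -- time zero.
    refine le_of_tendsto (ENNReal.Tendsto.const_mul h1
      (Or.inr (ENNReal.ofReal_ne_top (r := 1 / 2)))) (Eventually.of_forall fun n => ?_)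
    rw [← lintegral_klFun_heatFlow (by positivity)]
    exact lintegral_klFun_heatFlow_le (by positivity)

end

/-! ### Conditional divergence, least squares and the posterior mean of the noise -/

section

variable {D : ℕ} {S : Type*} [MeasurableSpace S]

lemma klDiv_map_measurableEquiv {α β : Type*} [MeasurableSpace α] [MeasurableSpace β]
    (μ ν : Measure α) [IsFiniteMeasure μ] [IsFiniteMeasure ν] (e : α ≃ᵐ β) :
    klDiv (μ.map e) (ν.map e) = klDiv μ ν := by
  apply le_antisymm (klDiv_map_le _ _ e.measurable)
  have h := klDiv_map_le (μ.map e) (ν.map e) e.symm.measurable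
  rwa [Measure.map_map e.symm.measurable e.measurable, Measure.map_map e.symm.measurable
    e.measurable, e.symm_comp_self, Measure.map_id, Measure.map_id] at h

/-- The conditional form of the chain rule: the divergence of two joint laws with the same marginal
is the average of the divergences of the conditional laws. -/
lemma klDiv_compProd_eq_lintegral {β : Type*} [MeasurableSpace β]
    [MeasurableSpace.CountablyGenerated β] (π : Measure S)
    [IsProbabilityMeasure π] (κ η : Kernel S β) [IsMarkovKernel κ] [IsMarkovKernel η]
    (hm : Measurable fun s => klDiv (κ s) (η s)) :
    klDiv (π ⊗ₘ κ) (π ⊗ₘ η) = ∫⁻ s, klDiv (κ s) (η s) ∂π := by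
  by_cases hac : ∀ᵐ s ∂π, κ s ≪ η s
  · have hjoint : π ⊗ₘ κ ≪ π ⊗ₘ η := Measure.absolutelyContinuous_compProd_right_iff.2 hac
    set r : S × β → ℝ≥0∞ := fun x => Kernel.rnDeriv κ η x.1 x.2 with hr
    have hrm : Measurable r := Kernel.measurable_rnDeriv κ η
    -- The jointly measurable density of the kernels is also the density of the joint laws.
    have hd : π ⊗ₘ κ = (π ⊗ₘ η).withDensity r := by
      ext A hA
      rw [withDensity_apply _ hA, Measure.compProd_apply hA, ← lintegral_indicator hA,
        Measure.lintegral_compProd (hrm.indicator hA)]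
      refine lintegral_congr_ae (hac.mono fun s hs => ?_)
      dsimp only
      rw [← Kernel.setLIntegral_rnDeriv hs (measurable_prodMk_left hA), ← lintegral_indicator
        (measurable_prodMk_left hA)]
      rfl
    have hrd : (π ⊗ₘ κ).rnDeriv (π ⊗ₘ η) =ᵐ[π ⊗ₘ η] r := by
      rw [hd]; exact Measure.rnDeriv_withDensity _ hrm
    have hkm : Measurable (fun x => ENNReal.ofReal (klFun (r x).toReal)) :=
      (measurable_klFun.comp hrm.ennreal_toReal).ennreal_ofReal
    rw [klDiv_eq_lintegral_klFun_of_ac hjoint, lintegral_congr_ae (hrd.mono fun x hx => by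
      show _ = ENNReal.ofReal (klFun (r x).toReal)
      rw [hx]), Measure.lintegral_compProd hkm]
    refine lintegral_congr_ae (hac.mono fun s hs => ?_)
    dsimp only
    rw [klDiv_eq_lintegral_klFun_of_ac hs]
    refine lintegral_congr_ae ((Kernel.rnDeriv_eq_rnDeriv_measure (κ := κ) (η := η) (a := s)).mono fun x hx => ?_)
    simp only [hr]
    rw [hx]
  -- Without absolute continuity both sides are infinite: a finite average would make almost every
  -- conditional divergence finite.
  · rw [klDiv_of_not_ac (fun h => hac (Measure.absolutelyContinuous_compProd_right_iff.1 h))]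
    by_contra hne
    refine hac ((ae_lt_top hm (Ne.symm hne)).mono fun s hs => ?_)
    by_contra h
    rw [klDiv_of_not_ac h] at hs
    exact lt_irrefl _ hs

/-- The conditional expectation minimizes the mean square error. -/
lemma lintegral_sub_condExp_le {Ω E : Type*} {m m₀ : MeasurableSpace Ω} {P : Measure Ω}
    [IsFiniteMeasure P] [NormedAddCommGroup E] [InnerProductSpace ℝ E] [CompleteSpace E]
    (hm : m ≤ m₀) {f h : Ω → E} (hf : MemLp f 2 P) (hh : MemLp h 2 P)
    (hhm : AEStronglyMeasurable[m] h P) :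
    ∫⁻ ω, ‖f ω - (P[f | m]) ω‖ₑ ^ 2 ∂P ≤ ∫⁻ ω, ‖f ω - h ω‖ₑ ^ 2 ∂P := by
  have : Fact (m ≤ m₀) := ⟨hm⟩
  have hmem : hh.toLp h ∈ lpMeas E ℝ m 2 P :=
    mem_lpMeas_iff_aestronglyMeasurable.2 (hhm.congr hh.coeFn_toLp.symm)
  -- In `L²` the conditional expectation is the orthogonal projection onto the `m`-measurable
  -- functions.
  have h1 : ‖hf.toLp f - (condExpL2 E ℝ hm (hf.toLp f) : Lp E 2 P)‖ ≤
      ‖hf.toLp f - hh.toLp h‖ := by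
    have h2 := Submodule.starProjection_minimal (U := lpMeas E ℝ m 2 P) (hf.toLp f)
    refine (le_of_eq h2).trans ?_
    exact ciInf_le ⟨0, by rintro _ ⟨w, rfl⟩; positivity⟩ (⟨hh.toLp h, hmem⟩ : lpMeas E ℝ m 2 P)
  have e : ∀ g : Ω → E, eLpNorm g 2 P ^ 2 = ∫⁻ ω, ‖g ω‖ₑ ^ 2 ∂P := by
    intro g
    have := eLpNorm_nnreal_pow_eq_lintegral (μ := P) (f := g) (p := 2) two_ne_zero
    simpa using this
  have hc := hf.condExpL2_ae_eq_condExp (E := E) (𝕜 := ℝ) hm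
  have e1 : ∫⁻ ω, ‖f ω - (P[f | m]) ω‖ₑ ^ 2 ∂P =
      ‖hf.toLp f - (condExpL2 E ℝ hm (hf.toLp f) : Lp E 2 P)‖ₑ ^ 2 := by
    rw [Lp.enorm_def, e]
    refine lintegral_congr_ae ?_
    filter_upwards [hf.coeFn_toLp, hc, Lp.coeFn_sub (hf.toLp f)
      (condExpL2 E ℝ hm (hf.toLp f) : Lp E 2 P)] with ω h3 h4 h5
    rw [h5, Pi.sub_apply, h3, h4]
  have e2 : ∫⁻ ω, ‖f ω - h ω‖ₑ ^ 2 ∂P = ‖hf.toLp f - hh.toLp h‖ₑ ^ 2 := by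
    rw [Lp.enorm_def, e]
    refine lintegral_congr_ae ?_
    filter_upwards [hf.coeFn_toLp, hh.coeFn_toLp, Lp.coeFn_sub (hf.toLp f) (hh.toLp h)]
      with ω h3 h4 h5
    rw [h5, Pi.sub_apply, h3, h4]
  rw [e1, e2]
  gcongr
  rw [← ofReal_norm, ← ofReal_norm]
  exact ENNReal.ofReal_le_ofReal h1

/-- The posterior mean of the noise `ε` given `z + √t ε = y`, where `z ∼ μ`. -/
noncomputable def denoiser (μ : Measure (Latent D)) (t : ℝ) (y : Latent D) : Latent D :=
  WithLp.toLp 2 fun i => -√t * (heatGrad μ t i y / heatFlow μ t y)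

lemma enorm_sq_eq_ofReal_sum (v : Latent D) : ‖v‖ₑ ^ 2 = ENNReal.ofReal (∑ i, v i ^ 2) := by
  rw [← ofReal_norm, ← ENNReal.ofReal_pow (norm_nonneg _), EuclideanSpace.real_norm_sq_eq]

lemma measurable_denoiser_kernel (κ : Kernel S (Latent D)) [IsSFiniteKernel κ] :
    Measurable (fun r : S × ℝ × Latent D => denoiser (κ r.1) r.2.1 r.2.2) := by
  unfold denoiser
  refine (WithLp.measurable_toLp 2 _).comp (measurable_pi_lambda _ fun i => ?_)
  exact Measurable.mul (by fun_prop)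
    ((measurable_heatGrad_kernel κ i).div (measurable_heatFlow_kernel κ))

lemma measurable_denoiser (μ : Measure (Latent D)) [SFinite μ] (t : ℝ) :
    Measurable (denoiser μ t) :=
  (measurable_denoiser_kernel (Kernel.const Unit μ)).comp
    (f := fun y => ((), t, y)) (by fun_prop)

/-- The relative Fisher information measures the distance of the two posterior means. -/
lemma ofReal_heatFlow_mul_enorm_denoiser_sub (μ ν : Measure (Latent D)) [IsProbabilityMeasure μ]
    {t : ℝ} (ht : 0 < t) (y : Latent D) :
    ENNReal.ofReal (heatFlow μ t y) * ‖denoiser μ t y - denoiser ν t y‖ₑ ^ 2 =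
      ENNReal.ofReal t * ENNReal.ofReal (fisherDensity μ ν t y) := by
  rw [enorm_sq_eq_ofReal_sum, ← ENNReal.ofReal_mul (heatFlow_pos ht y).le,
    ← ENNReal.ofReal_mul ht.le]
  congr 1
  unfold fisherDensity denoiser
  rw [mul_left_comm, Finset.mul_sum _ _ t]
  congr 1
  refine Finset.sum_congr rfl fun i _ => ?_
  simp only [PiLp.sub_apply]
  rw [← mul_sub, mul_pow, neg_sq, Real.sq_sqrt ht.le]

variable (μ : Measure (Latent D)) [IsProbabilityMeasure μ]

lemma sq_inv_sqrt_mul_sub {t : ℝ} (ht : 0 < t) (a c : ℝ) :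
    ((√t)⁻¹ * a - c) ^ 2 = 1 / t * a ^ 2 + (-(2 * c / √t) * a + c ^ 2 * 1) := by
  have hs : 0 < √t := Real.sqrt_pos.2 ht
  have : (1 : ℝ) / t = (√t)⁻¹ ^ 2 := by rw [inv_pow, Real.sq_sqrt ht.le, one_div]
  rw [this]
  field_simp
  ring

lemma QuadWeight.sq_inv_sqrt_mul_apply_sub {t : ℝ} (ht : 0 < t) (i : Fin D) (c : ℝ) :
    QuadWeight (fun v : Latent D => ((√t)⁻¹ * v i - c) ^ 2) := by
  simp_rw [sq_inv_sqrt_mul_sub ht]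
  exact ((QuadWeight.apply_sq i).const_mul _).add (((QuadWeight.apply i).const_mul _).add
    ((QuadWeight.const 1).const_mul _))

lemma heatMoment_sq_inv_sqrt_mul_apply_sub {t : ℝ} (ht : 0 < t) (i : Fin D) (c : ℝ)
    (y : Latent D) :
    heatMoment μ (fun v => ((√t)⁻¹ * v i - c) ^ 2) t y =
      1 / t * heatMoment μ (fun y => y i ^ 2) t y + 2 * c * (√t * heatGrad μ t i y)
        + c ^ 2 * heatFlow μ t y := by
  have hs : 0 < √t := Real.sqrt_pos.2 ht
  simp_rw [sq_inv_sqrt_mul_sub ht]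
  rw [heatMoment_add ((QuadWeight.apply_sq i).const_mul _)
      (((QuadWeight.apply i).const_mul _).add ((QuadWeight.const 1).const_mul _)) ht,
    heatMoment_add ((QuadWeight.apply i).const_mul _) ((QuadWeight.const 1).const_mul _) ht,
    heatMoment_const_mul, heatMoment_const_mul, heatMoment_const_mul, heatGrad, heatFlow]
  have : √t * (-(1 / t)) = -(1 / √t) := by
    rw [← Real.sq_sqrt ht.le]
    rw [Real.sqrt_sq hs.le]
    field_simp
  rw [← mul_assoc (√t), this]
  ring

lemma lintegral_enorm_sub_sq_mul_heatKernel {t : ℝ} (ht : 0 < t) (y c : Latent D) :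
    ∫⁻ z, ‖(√t)⁻¹ • (y - z) - c‖ₑ ^ 2 * ENNReal.ofReal (heatKernel t (y - z)) ∂μ =
      ENNReal.ofReal (∑ i, heatMoment μ (fun v => ((√t)⁻¹ * v i - c i) ^ 2) t y) := by
  have hint := fun i =>
    (QuadWeight.sq_inv_sqrt_mul_apply_sub ht i (c i)).integrable (μ := μ) ht y
  have e1 : ∀ z, ‖(√t)⁻¹ • (y - z) - c‖ₑ ^ 2 * ENNReal.ofReal (heatKernel t (y - z)) =
      ENNReal.ofReal (∑ i, ((√t)⁻¹ * (y - z) i - c i) ^ 2 * heatKernel t (y - z)) := by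
    intro z
    rw [enorm_sq_eq_ofReal_sum, ← ENNReal.ofReal_mul (Finset.sum_nonneg fun _ _ => sq_nonneg _),
      Finset.sum_mul]
    rfl
  simp_rw [e1]
  rw [← ofReal_integral_eq_lintegral_ofReal (integrable_finsetSum _ fun i _ => hint i)
    (ae_of_all _ fun z => Finset.sum_nonneg fun i _ =>
      mul_nonneg (sq_nonneg _) (heatKernel_pos ht _).le),
    integral_finsetSum _ fun i _ => hint i]
  rfl

/-- Bias-variance decomposition at a fixed observation `y`. -/
lemma lintegral_enorm_sub_sq_eq_add {t : ℝ} (ht : 0 < t) (y c : Latent D) :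
    ∫⁻ z, ‖(√t)⁻¹ • (y - z) - c‖ₑ ^ 2 * ENNReal.ofReal (heatKernel t (y - z)) ∂μ =
      (∫⁻ z, ‖(√t)⁻¹ • (y - z) - denoiser μ t y‖ₑ ^ 2 *
        ENNReal.ofReal (heatKernel t (y - z)) ∂μ) +
      ENNReal.ofReal (heatFlow μ t y) * ‖denoiser μ t y - c‖ₑ ^ 2 := by
  have hu := heatFlow_pos (μ := μ) ht y
  have hs : 0 < √t := Real.sqrt_pos.2 ht
  have h0 : 0 ≤ ∑ i, heatMoment μ (fun v => ((√t)⁻¹ * v i - denoiser μ t y i) ^ 2) t y :=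
    Finset.sum_nonneg fun i _ => integral_nonneg fun z =>
      mul_nonneg (sq_nonneg _) (heatKernel_pos ht _).le
  rw [lintegral_enorm_sub_sq_mul_heatKernel μ ht, lintegral_enorm_sub_sq_mul_heatKernel μ ht,
    enorm_sq_eq_ofReal_sum, ← ENNReal.ofReal_mul hu.le, Finset.mul_sum,
    ← ENNReal.ofReal_add h0 (Finset.sum_nonneg fun i _ => by positivity),
    ← Finset.sum_add_distrib]
  congr 1
  refine Finset.sum_congr rfl fun i _ => ?_
  -- Tweedie's formula: the first moment of the noise at `y` is the density times the posterior
  -- mean. This makes the cross term of the square cancel.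
  have hden : √t * heatGrad μ t i y = -denoiser μ t y i * heatFlow μ t y := by
    unfold denoiser
    field_simp
  rw [heatMoment_sq_inv_sqrt_mul_apply_sub μ ht, heatMoment_sq_inv_sqrt_mul_apply_sub μ ht, hden,
    PiLp.sub_apply]
  ring

end

/-! ### Denoising errors of matched and mismatched estimators -/

section

variable {D : ℕ} {S : Type*} [MeasurableSpace S]

/-- The mean square error of the estimate `g (z + √t ε)` of the noise `ε`, where `z ∼ μ`. -/
noncomputable def noiseError (μ : Measure (Latent D)) (t : ℝ) (g : Latent D → Latent D) : ℝ≥0∞ :=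
  ∫⁻ z, ∫⁻ ε, ‖ε - g (z + √t • ε)‖ₑ ^ 2 ∂stdGaussian (Latent D) ∂μ

/-- The substitution `y = z + √t ε` recovers the noise as `(y - z)/√t`, and conditioning on `y`
becomes fixing it. -/
lemma noiseError_eq_lintegral (μ : Measure (Latent D)) [SFinite μ] {t : ℝ} (ht : 0 < t)
    {g : Latent D → Latent D} (hg : Measurable g) :
    noiseError μ t g = ∫⁻ y, ∫⁻ z, ‖(√t)⁻¹ • (y - z) - g y‖ₑ ^ 2 *
      ENNReal.ofReal (heatKernel t (y - z)) ∂μ := by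
  have hs : √t ≠ 0 := (Real.sqrt_pos.2 ht).ne'
  rw [lintegral_lintegral_swap]
  · refine lintegral_congr fun z => ?_
    rw [← lintegral_stdGaussian (fun y => ‖(√t)⁻¹ • (y - z) - g y‖ₑ ^ 2) (by fun_prop) ht z]
    simp [smul_smul, inv_mul_cancel₀ hs]
  · fun_prop

/-- Pythagoras, integrated over the observation. Being additive in `ℝ≥0∞`, it holds also for
estimators of infinite error. -/
lemma noiseError_eq_add (μ : Measure (Latent D)) [IsProbabilityMeasure μ] {t : ℝ} (ht : 0 < t)
    {g : Latent D → Latent D} (hg : Measurable g) :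
    noiseError μ t g = noiseError μ t (denoiser μ t) +
      ∫⁻ y, ENNReal.ofReal (heatFlow μ t y) * ‖denoiser μ t y - g y‖ₑ ^ 2 := by
  rw [noiseError_eq_lintegral μ ht hg, noiseError_eq_lintegral μ ht (measurable_denoiser μ t),
    ← lintegral_add_left]
  · exact lintegral_congr fun y => lintegral_enorm_sub_sq_eq_add μ ht y (g y)
  · have := measurable_denoiser μ t
    exact Measurable.lintegral_prod_right' (f := fun r : Latent D × Latent D =>
      ‖(√t)⁻¹ • (r.1 - r.2) - denoiser μ t r.1‖ₑ ^ 2 * ENNReal.ofReal (heatKernel t (r.1 - r.2)))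
      (by fun_prop)

lemma noiseError_denoiser (μ ν : Measure (Latent D)) [IsProbabilityMeasure μ] [SFinite ν]
    {t : ℝ} (ht : 0 < t) :
    noiseError μ t (denoiser ν t) = noiseError μ t (denoiser μ t) +
      ENNReal.ofReal t * ∫⁻ y, ENNReal.ofReal (fisherDensity μ ν t y) := by
  rw [noiseError_eq_add μ ht (measurable_denoiser ν t), ← lintegral_const_mul' _ _ (by simp)]
  simp_rw [ofReal_heatFlow_mul_enorm_denoiser_sub μ ν ht]

lemma measurable_lintegral_fisherDensity_kernel (κ η : Kernel S (Latent D)) [IsMarkovKernel κ]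
    [IsMarkovKernel η] :
    Measurable fun r : S × ℝ => ∫⁻ y, ENNReal.ofReal (fisherDensity (κ r.1) (η r.1) r.2 y) := by
  have h : Measurable fun r : (S × ℝ) × Latent D =>
      fisherDensity (κ r.1.1) (η r.1.1) r.1.2 r.2 :=
    (measurable_fisherDensity_kernel κ η).comp
      (f := fun r : (S × ℝ) × Latent D => (r.1.1, r.1.2, r.2)) (by fun_prop)
  exact h.ennreal_ofReal.lintegral_prod_right'

lemma lintegral_enorm_sq_stdGaussian_lt_top :
    ∫⁻ ε, ‖ε‖ₑ ^ 2 ∂stdGaussian (Latent D) < ∞ := by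
  have h : MemLp id 2 (stdGaussian (Latent D)) := IsGaussian.memLp_two_id
  have := eLpNorm_nnreal_pow_eq_lintegral (μ := stdGaussian (Latent D)) (f := id) (p := 2)
    two_ne_zero
  have h2 := ENNReal.pow_lt_top (n := 2) h.2
  simp at this
  rwa [this] at h2

/-- Comparison with the zero estimator. The resulting finiteness is what makes subtracting the
aligned error legitimate. -/
lemma noiseError_denoiser_le (μ : Measure (Latent D)) [IsProbabilityMeasure μ] {t : ℝ}
    (ht : 0 < t) :
    noiseError μ t (denoiser μ t) ≤ ∫⁻ ε, ‖ε‖ₑ ^ 2 ∂stdGaussian (Latent D) := by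
  have h := noiseError_eq_add μ ht (g := fun _ => 0) measurable_const
  have h2 : noiseError μ t (fun _ => 0) = ∫⁻ ε, ‖ε‖ₑ ^ 2 ∂stdGaussian (Latent D) := by
    simp [noiseError]
  rw [← h2, h]
  exact le_self_add

/-- `σ(-γ) = σ(γ) e^{-γ}`: up to an invertible scaling of the observation, noise level `γ` is heat
time `e^{-γ}`. -/
lemma noisy_eq_smul (γ : ℝ) (z ε : Latent D) :
    noisy γ z ε = √(Real.sigmoid γ) • (z + √(Real.exp (-γ)) • ε) := by
  have h : Real.sigmoid (-γ) = Real.sigmoid γ * Real.exp (-γ) := by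
    have := Real.exp_pos γ
    simp only [Real.sigmoid, Real.exp_neg, neg_neg]
    field_simp
    ring
  rw [noisy, smul_add, smul_smul, h, Real.sqrt_mul (Real.sigmoid_nonneg γ)]

lemma measurable_observation (γ : ℝ) :
    Measurable (observation (D := D) (S := S) γ) := by
  unfold observation noisy; fun_prop

lemma measurable_noiseError_kernel (κ : Kernel S (Latent D)) [IsSFiniteKernel κ] (t : ℝ)
    {g : S → Latent D → Latent D} (hg : Measurable fun r : S × Latent D => g r.1 r.2) :
    Measurable fun s => noiseError (κ s) t (g s) := by
  unfold noiseError
  have h1 : Measurable fun r : S × Latent D =>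
      ∫⁻ ε, ‖ε - g r.1 (r.2 + √t • ε)‖ₑ ^ 2 ∂stdGaussian (Latent D) := by
    refine Measurable.lintegral_prod_right' (f := fun r : (S × Latent D) × Latent D =>
      ‖r.2 - g r.1.1 (r.1.2 + √t • r.2)‖ₑ ^ 2) ?_
    have : Measurable fun r : (S × Latent D) × Latent D => g r.1.1 (r.1.2 + √t • r.2) :=
      hg.comp (f := fun r : (S × Latent D) × Latent D => (r.1.1, r.1.2 + √t • r.2)) (by fun_prop)
    fun_prop
  exact h1.lintegral_kernel_prod_right'

/-- Conditioning on `s`, with the scaling `√σ(γ)` absorbed into the estimator. It serves the aligned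
law and the product law alike, which differ only in `κ`. -/
lemma denoisingError_eq_lintegral {ν : Measure (Latent D × S)} [SFinite ν] {π : Measure S}
    [SFinite π] {κ : Kernel S (Latent D)} [IsSFiniteKernel κ] (hν : ν.map Prod.swap = π ⊗ₘ κ)
    {εhat : Latent D → ℝ → S → Latent D} {γ : ℝ}
    (hm : Measurable fun o : Latent D × S => εhat o.1 γ o.2) :
    denoisingError ν εhat γ = ∫⁻ s, noiseError (κ s) (Real.exp (-γ))
      (fun y => εhat (√(Real.sigmoid γ) • y) γ s) ∂π := by
  have h1 : Measurable fun r : (Latent D × S) × Latent D =>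
      ‖r.2 - εhat (noisy γ r.1.1 r.2) γ r.1.2‖ₑ ^ 2 := by
    have := hm.comp (measurable_observation (D := D) (S := S) γ)
    exact ((measurable_snd.sub this).enorm).pow_const 2
  have h2 := h1.lintegral_prod_right' (ν := stdGaussian (Latent D))
  rw [denoisingError, noiseLaw, lintegral_prod _ h1.aemeasurable]
  have h3 : ν = (π ⊗ₘ κ).map Prod.swap := by
    rw [← hν, Measure.map_map measurable_swap measurable_swap, Prod.swap_swap_eq, Measure.map_id]
  rw [h3, lintegral_map h2 measurable_swap]
  refine (Measure.lintegral_compProd (h2.comp measurable_swap)).trans ?_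
  simp_rw [noiseError, ← noisy_eq_smul]
  rfl

lemma memLp_snd_noiseLaw (p : Measure (Latent D × S)) [IsProbabilityMeasure p] :
    MemLp (fun ω : (Latent D × S) × Latent D => ω.2) 2 (noiseLaw p) := by
  have h : MemLp id 2 (stdGaussian (Latent D)) := IsGaussian.memLp_two_id
  exact h.comp_measurePreserving (f := Prod.snd) measurePreserving_snd

/-- Finite error places the competitor in `L²`, as the difference of the Gaussian noise and a
square-integrable residual; least squares then applies. -/
lemma denoisingError_le_of_isMMSEDenoiser {p : Measure (Latent D × S)} [IsProbabilityMeasure p]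
    {εhat : Latent D → ℝ → S → Latent D} (h : IsMMSEDenoiser p εhat) {γ : ℝ}
    {εtil : Latent D → ℝ → S → Latent D} (hm : Measurable fun o : Latent D × S => εtil o.1 γ o.2)
    (hfin : denoisingError p εtil γ ≠ ∞) :
    denoisingError p εhat γ ≤ denoisingError p εtil γ := by
  have : IsFiniteMeasure (noiseLaw p) := by unfold noiseLaw; infer_instance
  have hobs := measurable_observation (D := D) (S := S) γ
  set til : (Latent D × S) × Latent D → Latent D :=
    fun ω => εtil (observation γ ω).1 γ (observation γ ω).2 with htil
  have hm' : Measurable til := hm.comp hobs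
  have hf := memLp_snd_noiseLaw p
  have hd : MemLp (fun ω => ω.2 - til ω) 2 (noiseLaw p) := by
    refine ⟨(measurable_snd.sub hm').aestronglyMeasurable, ?_⟩
    have h1 := eLpNorm_nnreal_pow_eq_lintegral (μ := noiseLaw p) (f := fun ω => ω.2 - til ω)
      (p := 2) two_ne_zero
    have h2 : eLpNorm (fun ω => ω.2 - til ω) 2 (noiseLaw p) ^ 2 = denoisingError p εtil γ := by
      simpa [denoisingError, til, observation] using h1
    rw [lt_top_iff_ne_top]
    intro htop
    rw [htop] at h2
    exact hfin (by simpa using h2.symm)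
  have hh : MemLp til 2 (noiseLaw p) := by
    simpa only [Pi.sub_def, sub_sub_cancel] using hf.sub hd
  have hhm : AEStronglyMeasurable[MeasurableSpace.comap (observation γ) inferInstance] til
      (noiseLaw p) :=
    (hm.comp (comap_measurable (observation γ))).stronglyMeasurable.aestronglyMeasurable
  refine le_of_eq_of_le ?_ (lintegral_sub_condExp_le hobs.comap_le hf hh hhm)
  refine lintegral_congr_ae ((h.ae_eq_condExp γ).mono fun ω hω => ?_)
  dsimp only
  rw [← hω]
  rfl

section Disintegration

variable {p : Measure (Latent D × S)} [IsProbabilityMeasure p] {π : Measure S}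
  [IsProbabilityMeasure π] {κ : Kernel S (Latent D)} [IsMarkovKernel κ]

lemma measurable_denoiser_kernel_fixed (κ : Kernel S (Latent D)) [IsSFiniteKernel κ] (t : ℝ) :
    Measurable fun r : S × Latent D => denoiser (κ r.1) t r.2 :=
  (measurable_denoiser_kernel κ).comp (f := fun r : S × Latent D => (r.1, t, r.2)) (by fun_prop)

/-- The MMSE estimator is the posterior mean of the noise under the conditional law of the latent. -/
lemma IsMMSEDenoiser.eq_denoiser {εhat : Latent D → ℝ → S → Latent D} (h : IsMMSEDenoiser p εhat)
    (hp : p.map Prod.swap = π ⊗ₘ κ) (γ : ℝ) :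
    denoisingError p εhat γ = ∫⁻ s, noiseError (κ s) (Real.exp (-γ))
      (denoiser (κ s) (Real.exp (-γ))) ∂π ∧
    ∀ᵐ s ∂π, ∀ᵐ y, εhat (√(Real.sigmoid γ) • y) γ s = denoiser (κ s) (Real.exp (-γ)) y := by
  set t := Real.exp (-γ) with htdef
  have ht : 0 < t := Real.exp_pos _
  have hσ : √(Real.sigmoid γ) ≠ 0 := (Real.sqrt_pos.2 (Real.sigmoid_pos γ)).ne'
  set V := ∫⁻ s, noiseError (κ s) t (denoiser (κ s) t) ∂π with hV
  have hVtop : V < ∞ := by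
    refine (lintegral_mono fun s => noiseError_denoiser_le (κ s) ht).trans_lt ?_
    simpa using lintegral_enorm_sq_stdGaussian_lt_top
  have hden := measurable_denoiser_kernel_fixed κ t
  -- The conditional expectation is never computed. The posterior mean is a competitor, so the error
  -- of `εhat` is at most `V`; by Pythagoras it is also `V` plus an excess, which must vanish
  -- because `V` is finite.
  set til : Latent D → ℝ → S → Latent D :=
    fun x _ s => denoiser (κ s) t ((√(Real.sigmoid γ))⁻¹ • x) with htil
  have hmtil : Measurable fun o : Latent D × S => til o.1 γ o.2 :=
    hden.comp (f := fun o : Latent D × S => (o.2, (√(Real.sigmoid γ))⁻¹ • o.1)) (by fun_prop)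
  have htilV : denoisingError p til γ = V := by
    rw [denoisingError_eq_lintegral hp hmtil]
    simp [htil, smul_smul, inv_mul_cancel₀ hσ, hV, htdef]
  have hle : denoisingError p εhat γ ≤ V := htilV ▸
    denoisingError_le_of_isMMSEDenoiser h hmtil (htilV ▸ hVtop.ne)
  have hmg : Measurable fun r : S × Latent D => εhat (√(Real.sigmoid γ) • r.2) γ r.1 :=
    (h.measurable γ).comp (f := fun r : S × Latent D => (√(Real.sigmoid γ) • r.2, r.1))
      (by fun_prop)
  have hflow : Measurable fun r : S × Latent D => heatFlow (κ r.1) t r.2 :=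
    (measurable_heatFlow_kernel κ).comp (f := fun r : S × Latent D => (r.1, t, r.2)) (by fun_prop)
  have hR : Measurable fun r : S × Latent D => ENNReal.ofReal (heatFlow (κ r.1) t r.2) *
      ‖denoiser (κ r.1) t r.2 - εhat (√(Real.sigmoid γ) • r.2) γ r.1‖ₑ ^ 2 :=
    hflow.ennreal_ofReal.mul ((hden.sub hmg).enorm.pow_const 2)
  have hadd : denoisingError p εhat γ = V + ∫⁻ s, (∫⁻ y, ENNReal.ofReal (heatFlow (κ s) t y) *
      ‖denoiser (κ s) t y - εhat (√(Real.sigmoid γ) • y) γ s‖ₑ ^ 2) ∂π := by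
    rw [denoisingError_eq_lintegral hp (h.measurable γ), ← lintegral_add_right _
      hR.lintegral_prod_right']
    exact lintegral_congr fun s => noiseError_eq_add (κ s) ht (hmg.comp measurable_prodMk_left)
  refine ⟨le_antisymm hle (hadd ▸ le_self_add), ?_⟩
  have h0 : ∫⁻ s, (∫⁻ y, ENNReal.ofReal (heatFlow (κ s) t y) *
      ‖denoiser (κ s) t y - εhat (√(Real.sigmoid γ) • y) γ s‖ₑ ^ 2) ∂π = 0 := by
    rw [hadd] at hle
    by_contra hne
    exact absurd hle (not_le.2 (ENNReal.lt_add_right hVtop.ne hne))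
  filter_upwards [(lintegral_eq_zero_iff hR.lintegral_prod_right').1 h0] with s hs
  filter_upwards [(lintegral_eq_zero_iff (hR.comp measurable_prodMk_left)).1 hs] with y hy
  -- A positive density turns equality for the law of the observation into equality Lebesgue-almost
  -- everywhere, so that it remains valid under the mismatched law.
  have hu := heatFlow_pos (μ := κ s) ht y
  have := (mul_eq_zero.1 hy).resolve_left (by simpa using hu)
  rw [pow_eq_zero_iff two_ne_zero, enorm_eq_zero, sub_eq_zero] at this
  exact this.symm

omit [IsProbabilityMeasure p] in
lemma fst_eq_bind (hp : p.map Prod.swap = π ⊗ₘ κ) : p.fst = π.bind κ := by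
  rw [← Measure.snd_compProd, ← hp, Measure.snd_map_swap]

omit [IsProbabilityMeasure p] in
lemma snd_eq (hp : p.map Prod.swap = π ⊗ₘ κ) : p.snd = π := by
  rw [← Measure.fst_map_swap, hp, Measure.fst_compProd]

/-- Replacing the joint law by the product of its marginals increases the error of the MMSE
estimator by the average relative Fisher information in both directions. -/
lemma IsMMSEDenoiser.denoisingError_prod {εhat : Latent D → ℝ → S → Latent D}
    (h : IsMMSEDenoiser p εhat) (hp : p.map Prod.swap = π ⊗ₘ κ) (γ : ℝ) :
    denoisingError (p.fst.prod p.snd) εhat γ = denoisingError p εhat γ +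
      ENNReal.ofReal (Real.exp (-γ)) *
        ∫⁻ s, ((∫⁻ y, ENNReal.ofReal (fisherDensity (κ s) p.fst (Real.exp (-γ)) y)) +
          ∫⁻ y, ENNReal.ofReal (fisherDensity p.fst (κ s) (Real.exp (-γ)) y)) ∂π := by
  obtain ⟨hV, heq⟩ := h.eq_denoiser hp γ
  have hprod : (p.fst.prod p.snd).map Prod.swap = π ⊗ₘ Kernel.const S p.fst := by
    rw [Measure.prod_swap, Measure.compProd_const, snd_eq hp]
  rw [denoisingError_eq_lintegral hprod (h.measurable γ), hV]
  set t := Real.exp (-γ) with htdef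
  have ht : 0 < t := Real.exp_pos _
  have hmF := fun (κ η : Kernel S (Latent D)) [IsMarkovKernel κ] [IsMarkovKernel η] =>
    (measurable_lintegral_fisherDensity_kernel κ η).comp (measurable_prodMk_right (y := t))
  have hm1 := hmF κ (Kernel.const S p.fst)
  have hm2 := hmF (Kernel.const S p.fst) κ
  simp only [Kernel.const_apply, Function.comp_def] at hm1 hm2 ⊢
  have hmV : Measurable fun s => noiseError (κ s) t (denoiser (κ s) t) :=
    measurable_noiseError_kernel κ t (measurable_denoiser_kernel_fixed κ t)
  have hV0 : noiseError p.fst t (denoiser p.fst t) =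
      (∫⁻ s, noiseError (κ s) t (denoiser (κ s) t) ∂π) +
        ENNReal.ofReal t * ∫⁻ s, (∫⁻ y, ENNReal.ofReal (fisherDensity (κ s) p.fst t y)) ∂π := by
    rw [← lintegral_const_mul _ hm1, ← lintegral_add_left hmV]
    have hmf : Measurable fun z => ∫⁻ ε, ‖ε - denoiser p.fst t (z + √t • ε)‖ₑ ^ 2
        ∂stdGaussian (Latent D) := by
      have := measurable_denoiser p.fst t
      exact Measurable.lintegral_prod_right' (f := fun r : Latent D × Latent D =>
        ‖r.2 - denoiser p.fst t (r.1 + √t • r.2)‖ₑ ^ 2) (by fun_prop)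
    -- The error of a fixed estimator is linear in the law of `z`, and `p.fst` is the average of the
    -- `κ s`.
    have hb : noiseError p.fst t (denoiser p.fst t) =
        ∫⁻ s, noiseError (κ s) t (denoiser p.fst t) ∂π := by
      simp only [noiseError]
      rw [← Measure.lintegral_bind κ.aemeasurable hmf.aemeasurable, ← fst_eq_bind hp]
    rw [hb]
    exact lintegral_congr fun s => noiseError_denoiser (κ s) p.fst ht
  -- The estimator tuned to `κ s` is applied to `z ∼ p.fst`: this mismatch is the source of the
  -- reverse divergence, while `hV0` is that of the mutual information.
  have he : ∀ᵐ s ∂π, noiseError p.fst t (fun y => εhat (√(Real.sigmoid γ) • y) γ s) =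
      noiseError p.fst t (denoiser p.fst t) +
        ENNReal.ofReal t * ∫⁻ y, ENNReal.ofReal (fisherDensity p.fst (κ s) t y) := by
    filter_upwards [heq] with s hs
    have hmg : Measurable fun y : Latent D => εhat (√(Real.sigmoid γ) • y) γ s :=
      (h.measurable γ).comp (f := fun y : Latent D => (√(Real.sigmoid γ) • y, s)) (by fun_prop)
    rw [← noiseError_denoiser p.fst (κ s) ht, noiseError_eq_lintegral _ ht
      (measurable_denoiser _ _), noiseError_eq_lintegral _ ht hmg]
    exact lintegral_congr_ae (hs.mono fun y hy => by simp only [hy])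
  rw [lintegral_congr_ae he, lintegral_add_left measurable_const, lintegral_const, measure_univ,
    mul_one, hV0, lintegral_const_mul _ hm2, lintegral_add_left hm1, mul_add, add_assoc]

end Disintegration

end

/-! ### Integration over the noise level and the denoising gap -/

section

variable {D : ℕ} {S : Type*} [MeasurableSpace S]

/-- The substitution `t = e^{-γ}`: the factor `t` in the excess error is exactly its Jacobian, which
is why the gap integrates against `dγ`. -/
lemma lintegral_exp_neg_mul_comp (F : ℝ → ℝ≥0∞) :
    ∫⁻ γ, ENNReal.ofReal (Real.exp (-γ)) * F (Real.exp (-γ)) = ∫⁻ t in Ioi 0, F t := by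
  have himg : (fun γ : ℝ => Real.exp (-γ)) '' univ = Ioi 0 := by
    ext t
    constructor
    · rintro ⟨γ, -, rfl⟩; exact Real.exp_pos _
    · intro ht; exact ⟨-Real.log t, mem_univ _, by simp [Real.exp_log ht]⟩
  have hinj : InjOn (fun γ : ℝ => Real.exp (-γ)) univ := by
    intro a _ b _ h
    simpa using h
  have hderiv : ∀ γ ∈ (univ : Set ℝ), HasDerivWithinAt (fun γ : ℝ => Real.exp (-γ))
      (-Real.exp (-γ)) univ γ := by
    intro γ _
    simpa using (hasDerivAt_neg γ).exp
  have := lintegral_image_eq_lintegral_abs_deriv_mul MeasurableSet.univ hderiv hinj F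
  rw [himg] at this
  rw [this, Measure.restrict_univ]
  simp [abs_of_pos (Real.exp_pos _)]

lemma lintegral_exp_neg_mul_fisherDensity (π : Measure S) [IsProbabilityMeasure π]
    (κ η : Kernel S (Latent D)) [IsMarkovKernel κ] [IsMarkovKernel η] :
    ∫⁻ γ, ENNReal.ofReal (Real.exp (-γ)) *
      ∫⁻ s, (∫⁻ y, ENNReal.ofReal (fisherDensity (κ s) (η s) (Real.exp (-γ)) y)) ∂π =
    2 * klDiv (π ⊗ₘ κ) (π ⊗ₘ η) := by
  have hF : Measurable fun r : S × ℝ × Latent D =>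
      ENNReal.ofReal (fisherDensity (κ r.1) (η r.1) r.2.1 r.2.2) :=
    (measurable_fisherDensity_kernel κ η).ennreal_ofReal
  have hF2 := measurable_lintegral_fisherDensity_kernel κ η
  have hkl : ∀ s, ∫⁻ t in Ioi 0, ∫⁻ y, ENNReal.ofReal (fisherDensity (κ s) (η s) t y) =
      2 * klDiv (κ s) (η s) := by
    intro s
    have hs : Measurable fun r : ℝ × Latent D =>
        ENNReal.ofReal (fisherDensity (κ s) (η s) r.1 r.2) := hF.comp measurable_prodMk_left
    rw [klDiv_eq_lintegral_fisherDensity, lintegral_prod _ hs.aemeasurable, ← mul_assoc,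
      show (2 : ℝ≥0∞) * ENNReal.ofReal (1 / 2) = 1 by
        rw [one_div, ENNReal.ofReal_inv_of_pos two_pos, ENNReal.ofReal_ofNat,
          ENNReal.mul_inv_cancel two_ne_zero (by simp)], one_mul]
  -- Measurability of the conditional divergence is read off from its representation as a parametric
  -- Fisher integral.
  have hm : Measurable fun s => klDiv (κ s) (η s) := by
    have h1 : Measurable fun s =>
        ∫⁻ t in Ioi 0, ∫⁻ y, ENNReal.ofReal (fisherDensity (κ s) (η s) t y) :=
      hF2.lintegral_prod_right'
    simp_rw [hkl] at h1
    have h2 := h1.const_mul (2⁻¹ : ℝ≥0∞)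
    simpa [← mul_assoc, ENNReal.inv_mul_cancel] using h2
  have hswap : AEMeasurable (Function.uncurry fun (t : ℝ) s =>
      ∫⁻ y, ENNReal.ofReal (fisherDensity (κ s) (η s) t y)) ((volume.restrict (Ioi 0)).prod π) :=
    (hF2.comp measurable_swap).aemeasurable
  rw [lintegral_exp_neg_mul_comp (fun t =>
    ∫⁻ s, (∫⁻ y, ENNReal.ofReal (fisherDensity (κ s) (η s) t y)) ∂π),
    lintegral_lintegral_swap hswap, klDiv_compProd_eq_lintegral π κ η hm, ← lintegral_const_mul _ hm]
  exact lintegral_congr hkl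

lemma EReal_coe_sub_coe_add {a : ℝ≥0∞} (ha : a ≠ ∞) (b : ℝ≥0∞) :
    (a : EReal) - ((a + b : ℝ≥0∞) : EReal) = -(b : EReal) := by
  lift a to NNReal using ha
  induction b with
  | top => simp [EReal.sub_top]
  | coe b =>
    rw [← ENNReal.coe_add]
    change ((a : ℝ) : EReal) - (((a + b : NNReal) : ℝ) : EReal) = -((b : ℝ) : EReal)
    rw [← EReal.coe_sub, ← EReal.coe_neg]
    congr 1
    push_cast
    ring

lemma half_mul_zero_sub_two_mul (K : ℝ≥0∞) :
    ((1 / 2 : ℝ) : EReal) * (((0 : ℝ≥0∞) : EReal) - ((2 * K : ℝ≥0∞) : EReal)) = -(K : EReal) := by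
  rw [EReal.coe_ennreal_zero, zero_sub, mul_neg, EReal.coe_ennreal_mul, ← mul_assoc]
  have : ((1 / 2 : ℝ) : EReal) * ((2 : ℝ≥0∞) : EReal) = 1 := by
    change ((1 / 2 : ℝ) : EReal) * ((2 : ℝ) : EReal) = 1
    norm_cast
    norm_num
  rw [this, one_mul]

/-- The denoising gap for negatives that are independent of the input. -/
theorem gap_eq_neg_jeffreysDiv (p : Measure (Latent D × S)) [IsProbabilityMeasure p]
    (q : Kernel (Latent D) S) [IsMarkovKernel q] (hq : ∀ᵐ z ∂p.fst, q z = p.snd)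
    (εhat : Latent D → ℝ → S → Latent D) (h : IsMMSEDenoiser p εhat) :
    gap p q εhat = -(jeffreysDiv p (p.fst.prod p.snd) : EReal) := by
  -- Swapping puts the latent second: `S` is an arbitrary measurable space, and conditional laws are
  -- available because the conditioned variable `z` lives in a standard Borel space.
  set ρ := p.map Prod.swap with hρ
  have : IsProbabilityMeasure ρ := Measure.isProbabilityMeasure_map measurable_swap.aemeasurable
  set π := ρ.fst
  set κ := ρ.condKernel
  have hp : p.map Prod.swap = π ⊗ₘ κ := (Measure.disintegrate ρ κ).symm
  have hprod : (p.fst.prod p.snd).map Prod.swap = π ⊗ₘ Kernel.const S p.fst := by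
    rw [Measure.prod_swap, Measure.compProd_const, snd_eq hp]
  have hqprod : p.fst ⊗ₘ q = p.fst.prod p.snd := by
    rw [← Measure.compProd_const]
    exact Measure.compProd_congr hq
  have hfin : ∀ γ, denoisingError p εhat γ ≠ ∞ := by
    intro γ
    rw [(h.eq_denoiser hp γ).1]
    refine ((lintegral_mono fun s =>
      noiseError_denoiser_le (κ s) (Real.exp_pos (-γ))).trans_lt ?_).ne
    simpa using lintegral_enorm_sq_stdGaussian_lt_top
  have h1 := lintegral_exp_neg_mul_fisherDensity π κ (Kernel.const S p.fst)
  have h2 := lintegral_exp_neg_mul_fisherDensity π (Kernel.const S p.fst) κ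
  rw [← hp, ← hprod] at h1 h2
  simp only [Kernel.const_apply] at h1 h2
  have hk1 : klDiv (p.map Prod.swap) ((p.fst.prod p.snd).map Prod.swap) = _ :=
    klDiv_map_measurableEquiv p (p.fst.prod p.snd) MeasurableEquiv.prodComm
  have hk2 : klDiv ((p.fst.prod p.snd).map Prod.swap) (p.map Prod.swap) = _ :=
    klDiv_map_measurableEquiv (p.fst.prod p.snd) p MeasurableEquiv.prodComm
  rw [hk1] at h1
  rw [hk2] at h2
  set G : ℝ → ℝ≥0∞ := fun γ => ENNReal.ofReal (Real.exp (-γ)) *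
    ∫⁻ s, ((∫⁻ y, ENNReal.ofReal (fisherDensity (κ s) p.fst (Real.exp (-γ)) y)) +
      ∫⁻ y, ENNReal.ofReal (fisherDensity p.fst (κ s) (Real.exp (-γ)) y)) ∂π with hG
  have hdiff : ∀ γ, (denoisingError p εhat γ : EReal) -
      (denoisingError (p.fst ⊗ₘ q) εhat γ : EReal) = -(G γ : EReal) := by
    intro γ
    rw [hqprod, h.denoisingError_prod hp γ]
    exact EReal_coe_sub_coe_add (hfin γ) _
  have hGint : ∫⁻ γ, G γ = 2 * jeffreysDiv p (p.fst.prod p.snd) := by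
    have hm1 : Measurable fun r : ℝ × S => ∫⁻ y, ENNReal.ofReal
        (fisherDensity (κ r.2) p.fst (Real.exp (-r.1)) y) :=
      (measurable_lintegral_fisherDensity_kernel κ (Kernel.const S p.fst)).comp
        (f := fun r : ℝ × S => (r.2, Real.exp (-r.1))) (by fun_prop)
    have hm1' : ∀ γ, Measurable fun s => ∫⁻ y, ENNReal.ofReal
        (fisherDensity (κ s) p.fst (Real.exp (-γ)) y) := fun γ => hm1.comp measurable_prodMk_left
    have hm2 : Measurable fun γ => ENNReal.ofReal (Real.exp (-γ)) *
      ∫⁻ s, (∫⁻ y, ENNReal.ofReal (fisherDensity (κ s) p.fst (Real.exp (-γ)) y)) ∂π :=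
      (by fun_prop : Measurable fun γ : ℝ => ENNReal.ofReal (Real.exp (-γ))).mul
        hm1.lintegral_prod_right'
    rw [jeffreysDiv, mul_add, ← h1, ← h2, ← lintegral_add_left hm2]
    refine lintegral_congr fun γ => ?_
    rw [← mul_add, ← lintegral_add_left (hm1' γ)]
  unfold gap extIntegral
  simp_rw [hdiff, neg_neg, EReal.toENNReal_coe]
  -- The integrand is nowhere positive, so the extended integral has zero positive part and no `∞ -
  -- ∞` arises.
  have hneg : ∀ γ, (-(G γ : EReal)).toENNReal = 0 := fun γ =>
    EReal.toENNReal_of_nonpos (EReal.neg_le_zero.2 (EReal.coe_ennreal_nonneg _))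
  simp_rw [hneg]
  rw [lintegral_zero, hGint, half_mul_zero_sub_two_mul]

end

end DenoisingGap


theorem corollary1 {D : ℕ} {S : Type*} [MeasurableSpace S] {Φ : Type*}
    (p : Φ → Measure (DenoisingGap.Latent D × S)) [∀ φ, IsProbabilityMeasure (p φ)]
    (q : Φ → Kernel (DenoisingGap.Latent D) S) [∀ φ, IsMarkovKernel (q φ)]
    (hq : ∀ φ, ∀ᵐ z ∂(p φ).fst, q φ z = (p φ).snd)
    (εhat : Φ → DenoisingGap.Latent D → ℝ → S → DenoisingGap.Latent D)
    (hεhat : ∀ φ, DenoisingGap.IsMMSEDenoiser (p φ) (εhat φ)) :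
    (∀ φ, DenoisingGap.gap (p φ) (q φ) (εhat φ) =
      -(DenoisingGap.mutualInfo (p φ) : EReal)
        - (klDiv ((p φ).fst.prod (p φ).snd) (p φ) : EReal)) ∧
    (∀ φ, (∀ ψ, DenoisingGap.gap (p φ) (q φ) (εhat φ) ≤ DenoisingGap.gap (p ψ) (q ψ) (εhat ψ)) ↔
      (∀ ψ, DenoisingGap.jeffreysDiv (p ψ) ((p ψ).fst.prod (p ψ).snd) ≤
        DenoisingGap.jeffreysDiv (p φ) ((p φ).fst.prod (p φ).snd))) := by
  have hgap := fun φ =>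
    DenoisingGap.gap_eq_neg_jeffreysDiv (p φ) (q φ) (hq φ) (εhat φ) (hεhat φ)
  refine ⟨fun φ => ?_, fun φ => forall_congr' fun ψ => ?_⟩
  · rw [hgap, DenoisingGap.jeffreysDiv, DenoisingGap.mutualInfo, EReal.coe_ennreal_add,
      EReal.neg_add (Or.inl (EReal.coe_ennreal_ne_bot _)) (Or.inr (EReal.coe_ennreal_ne_bot _))]
  · rw [hgap, hgap, EReal.neg_le_neg_iff, EReal.coe_ennreal_le_coe_ennreal_iff]
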